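/- Theorem. In each time slot $t=1,2,\dots$ a user requests energy $X_t\ge 0$ and a harvester makes $E_t\ge 0$ units of energy available at the beginning of the slot. The $X_t$ are i.i.d. with a discrete distribution $p_X$ of finite entropy, the $E_t$ are i.i.d. with distribution $p_E$ and finite mean $\bar P_E=\mathbb E[E_t]$, and the two sequences are independent. A length-$n$ energy management policy chooses the energy $Y_t\ge 0$ drawn from the grid in slot $t$ by a randomized function of $X^t$, $Y^{t-1}$, of the battery states $S^t$ at the beginnings of the slots $1,\dots,t$, and of $E_t$. Here $S_1=0$ and, the battery capacity being infinite, $S_{t+1}=\max\{S_t+E_t-(X_t-Y_t),0\}$. The policy is feasible if, almost surely, $0\le Y_t\le X_t$ for all $t\le n$ and $\sum_{t=1}^k (X_t-Y_t)\le\sum_{t=1}^k E_t$ for all $k\le n$. Its information leakage rate is $I_n=\frac1n I(X^n;Y^n)$. A rate $r$ is achievable if there is a sequence of feasible length-$n$ policies for which $\lim_{n\to\infty} I_n$ exists and is at most $r$; let $\mathcal I_\infty$ be the infimum of the achievable rates. Let the privacy-power function $\mathcal I(\bar P,\hat P)$ be the infimum of the rates achievable, in the same sense, by policies choosing $Y_t\ge0$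 by a randomized function of $(X^t,Y^{t-1})$, subject only to $\mathbb E\big[\frac1n\sum_{t=1}^n (X_t-Y_t)\big]\le\bar P$ and $0\le X_t-Y_t\le\hat P$ almost surely for $t\le n$. Then $$\mathcal I_\infty=\mathcal I(\bar P_E,\infty)=\inf_{\substack{p_{Y|X}:\ 0\le X-Y,\\ \mathbb E[X-Y]\le\bar P_E}} I(X;Y),$$ where the infimum is over the conditional distributions of $Y\ge 0$ given $X\sim p_X$. The value of $\mathcal I_\infty$ is the same if only the policies that do not use $E_t$ in slot $t$ are allowed. -/

import Mathlib

open MeasureTheory ProbabilityTheory Filter Topology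
open scoped NNReal ENNReal unitInterval

namespace SmartMeter

noncomputable section

/-- Mutual information `I(X;Y)` (in nats, possibly `∞`): the Kullback-Leibler divergence of the
joint law of `(X, Y)` from the product of the marginal laws. -/
def mutualInfo {Ω α β : Type*} [MeasurableSpace Ω] [MeasurableSpace α] [MeasurableSpace β]
    (μ : Measure Ω) (X : Ω → α) (Y : Ω → β) : ℝ≥0∞ :=
  InformationTheory.klDiv (μ.map fun ω => (X ω, Y ω)) ((μ.map X).prod (μ.map Y))

/-- A discrete distribution of finite Shannon entropy: it is carried by its atoms, and
`∑ₓ - p(x) log p(x)` converges. -/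
def FiniteEntropy {α : Type*} [MeasurableSpace α] (p : Measure α) : Prop :=
  (∀ᵐ x ∂p, p {x} ≠ 0) ∧ Summable fun x => Real.negMulLog (p.real {x})

/-! ### The energy-harvesting system with a battery of infinite capacity -/

/-- An outcome: for each time slot (the first one has index `0`) the input load, the harvested
energy, and a private random seed of the energy management unit. -/
abbrev Outcome : Type := ℕ → ℝ≥0 × ℝ≥0 × I

/-- Input loads i.i.d. with law `pX`, harvested energies i.i.d. with law `pE`, seeds i.i.d. uniform
on `[0,1]`, all independent. -/
def outcomeLaw (pX pE : Measure ℝ≥0) [IsProbabilityMeasure pX] [IsProbabilityMeasure pE] :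
    Measure Outcome :=
  Measure.infinitePi fun _ : ℕ => pX.prod (pE.prod (volume : Measure I))

/-- The input load in slot `t`. -/
def inputLoad (t : ℕ) (ω : Outcome) : ℝ≥0 := (ω t).1

/-- The energy harvested for use from slot `t` on. -/
def harvest (t : ℕ) (ω : Outcome) : ℝ≥0 := (ω t).2.1

/-- The private random seed of slot `t`. -/
def seed (t : ℕ) (ω : Outcome) : I := (ω t).2.2

/-- Random power allocation functions: in slot `t` the output load is
`alloc t (u, x^t, y^{t-1}, s^t, e_t)`, where `u` is a fresh seed (uniform on `[0,1]`, which realizes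
every conditional distribution of the output load), `x^t` are the input loads up to `t`, `y^{t-1}`
the output loads before `t`, `s^t` the battery states at the beginning of the slots up to `t`, and
`e_t` the energy that becomes available at the beginning of slot `t`.
A policy of length `n` uses only the functions with `t < n`. -/
structure Policy where
  alloc : ∀ t : ℕ,
    I × (Fin (t + 1) → ℝ≥0) × (Fin t → ℝ≥0) × (Fin (t + 1) → ℝ) × ℝ≥0 → ℝ≥0
  measurable_alloc : ∀ t, Measurable (alloc t)

/-- The policy uses only the seed, `x^t`, `y^{t-1}` and `s^t`, and not `e_t`. -/
def Policy.IgnoresCurrentHarvest (π : Policy) : Prop :=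
  ∀ t u x y s e e', π.alloc t (u, x, y, s, e) = π.alloc t (u, x, y, s, e')

/-- Battery update for infinite capacity: state `s`, harvested energy `e`, input load `x`,
output load `y`. -/
def nextBattery (s : ℝ) (e x y : ℝ≥0) : ℝ := max (s + e - ((x : ℝ) - y)) 0

/-- The pair (output loads before slot `t`, battery states up to slot `t`); the battery is
initially empty. -/
def Policy.run (π : Policy) (ω : Outcome) : (t : ℕ) → (Fin t → ℝ≥0) × (Fin (t + 1) → ℝ)
  | 0 => (Fin.elim0, fun _ => 0)
  | t + 1 =>
    let y := (π.run ω t).1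
    let s := (π.run ω t).2
    let yt := π.alloc t (seed t ω, fun i => inputLoad i ω, y, s, harvest t ω)
    (Fin.snoc (α := fun _ => ℝ≥0) y yt,
      Fin.snoc (α := fun _ => ℝ) s
        (nextBattery (s (Fin.last t)) (harvest t ω) (inputLoad t ω) yt))

/-- The output load in slot `t`. -/
def Policy.output (π : Policy) (t : ℕ) (ω : Outcome) : ℝ≥0 := (π.run ω (t + 1)).1 (Fin.last t)

/-- Feasibility of a policy over the first `n` slots: almost surely `0 ≤ Y_t ≤ X_t` in every slot
(nonnegativity is in the type), and the energy taken from the battery up to any slot never exceeds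
the energy harvested so far. -/
def Policy.Feasible (pX pE : Measure ℝ≥0) [IsProbabilityMeasure pX] [IsProbabilityMeasure pE]
    (n : ℕ) (π : Policy) : Prop :=
  ∀ᵐ ω ∂(outcomeLaw pX pE),
    (∀ t < n, π.output t ω ≤ inputLoad t ω) ∧
    ∀ k ≤ n, ∑ t ∈ Finset.range k, ((inputLoad t ω : ℝ) - π.output t ω) ≤
      ∑ t ∈ Finset.range k, (harvest t ω : ℝ)

/-- The information leakage rate `I_n = (1/n) I(X^n; Y^n)`. -/
def Policy.leakageRate (pX pE : Measure ℝ≥0) [IsProbabilityMeasure pX] [IsProbabilityMeasure pE]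
    (n : ℕ) (π : Policy) : ℝ≥0∞ :=
  mutualInfo (outcomeLaw pX pE) (fun ω (t : Fin n) => inputLoad t ω)
    (fun ω (t : Fin n) => π.output t ω) / n

/-- `r` is achievable by feasible policies from the class `𝒞`: for some sequence of them, of lengths
`n = 0, 1, 2, …`, the limit of `I_n` exists and is at most `r`. -/
def Achievable (pX pE : Measure ℝ≥0) [IsProbabilityMeasure pX] [IsProbabilityMeasure pE]
    (𝒞 : Set Policy) (r : ℝ≥0∞) : Prop :=
  ∃ π : ℕ → Policy, (∀ n, π n ∈ 𝒞 ∧ (π n).Feasible pX pE n) ∧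
    ∃ l ≤ r, Tendsto (fun n => (π n).leakageRate pX pE n) atTop (𝓝 l)

/-- The minimum information leakage rate over the class `𝒞` of policies: the infimum of the
achievable rates. -/
def minLeakageRate (pX pE : Measure ℝ≥0) [IsProbabilityMeasure pX] [IsProbabilityMeasure pE]
    (𝒞 : Set Policy) : ℝ≥0∞ :=
  sInf {r | Achievable pX pE 𝒞 r}

/-! ### The privacy-power function: only average and peak power are constrained -/

/-- An outcome for the power-constrained system: input load and random seed in each slot. -/
abbrev PowerOutcome : Type := ℕ → ℝ≥0 × I

/-- Input loads i.i.d. with law `pX`, seeds i.i.d. uniform on `[0,1]`, all independent. -/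
def powerOutcomeLaw (pX : Measure ℝ≥0) [IsProbabilityMeasure pX] : Measure PowerOutcome :=
  Measure.infinitePi fun _ : ℕ => pX.prod (volume : Measure I)

/-- Random power allocation functions of the power-constrained system: in slot `t` the output load
is `alloc t (u, x^t, y^{t-1})`. -/
structure PowerPolicy where
  alloc : ∀ t : ℕ, I × (Fin (t + 1) → ℝ≥0) × (Fin t → ℝ≥0) → ℝ≥0
  measurable_alloc : ∀ t, Measurable (alloc t)

/-- The output loads before slot `t`. -/
def PowerPolicy.run (π : PowerPolicy) (ω : PowerOutcome) : (t : ℕ) → (Fin t → ℝ≥0)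
  | 0 => Fin.elim0
  | t + 1 => Fin.snoc (α := fun _ => ℝ≥0) (π.run ω t)
      (π.alloc t ((ω t).2, fun i => (ω i).1, π.run ω t))

/-- The output load in slot `t`. -/
def PowerPolicy.output (π : PowerPolicy) (t : ℕ) (ω : PowerOutcome) : ℝ≥0 :=
  π.run ω (t + 1) (Fin.last t)

/-- The average power constraint `E[(1/n) ∑ (X_t - Y_t)] ≤ Pavg` and the almost sure constraint
`0 ≤ X_t - Y_t ≤ Ppeak` over the first `n` slots. -/
def PowerPolicy.Feasible (pX : Measure ℝ≥0) [IsProbabilityMeasure pX] (Pavg Ppeak : ℝ≥0∞)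
    (n : ℕ) (π : PowerPolicy) : Prop :=
  (∀ᵐ ω ∂(powerOutcomeLaw pX), ∀ t < n, π.output t ω ≤ (ω t).1 ∧
    ENNReal.ofReal (((ω t).1 : ℝ) - π.output t ω) ≤ Ppeak) ∧
  ∫⁻ ω, (∑ t ∈ Finset.range n, ENNReal.ofReal (((ω t).1 : ℝ) - π.output t ω)) / n
    ∂(powerOutcomeLaw pX) ≤ Pavg

/-- The information leakage rate `(1/n) I(X^n; Y^n)` of a policy of the power-constrained system. -/
def PowerPolicy.leakageRate (pX : Measure ℝ≥0) [IsProbabilityMeasure pX] (n : ℕ)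
    (π : PowerPolicy) : ℝ≥0∞ :=
  mutualInfo (powerOutcomeLaw pX) (fun ω (t : Fin n) => (ω t).1)
    (fun ω (t : Fin n) => π.output t ω) / n

/-- The privacy-power function: the infimum of the leakage rates that are achievable under an
average power constraint `Pavg` and a peak power constraint `Ppeak`. -/
def privacyPower (pX : Measure ℝ≥0) [IsProbabilityMeasure pX] (Pavg Ppeak : ℝ≥0∞) : ℝ≥0∞ :=
  sInf {r | ∃ π : ℕ → PowerPolicy, (∀ n, (π n).Feasible pX Pavg Ppeak n) ∧
    ∃ l ≤ r, Tendsto (fun n => (π n).leakageRate pX n) atTop (𝓝 l)}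

/-- The single-letter expression: the infimum of `I(X;Y)` over all conditional distributions
`p_{Y|X}` with `0 ≤ X - Y ≤ Ppeak` almost surely and `E[X - Y] ≤ Pavg`. -/
def singleLetterLeakage (pX : Measure ℝ≥0) (Pavg Ppeak : ℝ≥0∞) : ℝ≥0∞ :=
  ⨅ κ ∈ {κ : Kernel ℝ≥0 ℝ≥0 | IsMarkovKernel κ ∧
      (∀ᵐ q ∂(pX ⊗ₘ κ), q.2 ≤ q.1 ∧ ENNReal.ofReal ((q.1 : ℝ) - q.2) ≤ Ppeak) ∧
      ∫⁻ q, ENNReal.ofReal ((q.1 : ℝ) - q.2) ∂(pX ⊗ₘ κ) ≤ Pavg},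
    mutualInfo (pX ⊗ₘ κ) Prod.fst Prod.snd

end

end SmartMeter

namespace SmartMeter

/-! Converse (`singleLetterLeakage_le`). Let `P` be the time average of the laws of `(X_t, Y_t)`.
Its first marginal is `pX` and its mean drawn energy respects the budget, so `I(P)` is at least the
single-letter infimum. If `f` is the density of `P` against the product of its marginals, then `∏
f(x_t, y_t)` integrates to at most `1` against `pX^n` for every fixed `y^n`, however the `Y_t`
depend on each other. The Gibbs variational bound then gives `I(X^n; Y^n) ≥ ∑ E log f(X_t, Y_t) = n
I(P)`; neither a chain rule nor convexity of mutual information is invoked.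

Achievability (`exists_revealPolicy_leakageRate_le`). For a near-optimal kernel `κ`, draw proposals
`Ŷ_t` from `κ` slot by slot. Output `X_t` itself when a coin of probability `ε` says so or the
battery cannot cover `X_t - Ŷ_t`, and `Ŷ_t` otherwise. The coin lowers the mean demand strictly
below a positive harvest mean, so by the strong law the battery eventually always suffices; if the
harvest mean is zero, the demand vanishes almost surely. Hence the average probability of a forced
revelation tends to `0`. The battery makes the revelation events depend on the past, yet
`mutualInfo_le_of_reveal` charges only for describing which loads are revealed and their values, and
finite entropy makes this small on rare events.

The lower bound holds for every policy and the construction never looks at the current harvest, so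
both classes of policies give the same value. The power-constrained problem has the same converse,
and memoryless sampling from `κ` achieves it. -/

/-! ### Variational bounds for mutual information -/

/-- Integrate `g + 1 ≤ exp g`. Every comparison of information quantities below reduces to this,
with `g` a difference of log-likelihoods. -/
lemma integral_nonpos_of_lintegral_exp_le_one {γ : Type*} [MeasurableSpace γ] {P : Measure γ}
    [IsProbabilityMeasure P] {g : γ → ℝ} (hg : Integrable g P)
    (h : ∫⁻ x, ENNReal.ofReal (Real.exp (g x)) ∂P ≤ 1) : ∫ x, g x ∂P ≤ 0 := by
  have hm : AEStronglyMeasurable (fun x => Real.exp (g x)) P :=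
    (Real.measurable_exp.comp_aemeasurable hg.aemeasurable).aestronglyMeasurable
  have hnn : 0 ≤ᵐ[P] fun x => Real.exp (g x) := ae_of_all _ fun x => (Real.exp_pos _).le
  have hexp : Integrable (fun x => Real.exp (g x)) P :=
    (lintegral_ofReal_ne_top_iff_integrable hm hnn).1 (ne_top_of_le_ne_top ENNReal.one_ne_top h)
  have h1 : ∫ x, Real.exp (g x) ∂P ≤ 1 := by
    rw [integral_eq_lintegral_of_nonneg_ae hnn hm]
    exact ENNReal.toReal_le_of_le_ofReal zero_le_one (by simpa using h)
  calc ∫ x, g x ∂P ≤ ∫ x, (Real.exp (g x) - 1) ∂P :=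
        integral_mono hg (hexp.sub (integrable_const _)) fun x => by
          linarith [Real.add_one_le_exp (g x)]
    _ = ∫ x, Real.exp (g x) ∂P - 1 := by rw [integral_sub hexp (integrable_const _)]; simp
    _ ≤ 0 := by linarith

/-- The Gibbs variational bound for subnormalized likelihood ratios. -/
lemma ofReal_integral_log_le_klDiv {γ : Type*} [MeasurableSpace γ] {P Q : Measure γ}
    [IsProbabilityMeasure P] [IsProbabilityMeasure Q] {f : γ → ℝ≥0} (hf : Measurable f)
    (hQ : ∫⁻ x, f x ∂Q ≤ 1) (hpos : ∀ᵐ x ∂P, 0 < f x)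
    (hint : Integrable (fun x => Real.log (f x)) P) :
    ENNReal.ofReal (∫ x, Real.log (f x) ∂P) ≤ InformationTheory.klDiv P Q := by
  by_cases htop : InformationTheory.klDiv P Q = ∞
  · simp [htop]
  obtain ⟨hac, hllr⟩ := InformationTheory.klDiv_ne_top_iff.1 htop
  rw [InformationTheory.klDiv_of_ac_of_integrable hac hllr]
  simp only [probReal_univ, add_sub_cancel_right]
  refine ENNReal.ofReal_le_ofReal ?_
  suffices ∫ x, (Real.log (f x) - llr P Q x) ∂P ≤ 0 by
    rw [integral_sub hint hllr] at this; linarith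
  refine integral_nonpos_of_lintegral_exp_le_one (hint.sub hllr) ?_
  have hD : ∀ᵐ x ∂P, ENNReal.ofReal (Real.exp (Real.log (f x) - llr P Q x)) =
      (f x : ℝ≥0∞) / P.rnDeriv Q x := by
    filter_upwards [hpos, Measure.rnDeriv_pos hac, hac.ae_le (Measure.rnDeriv_lt_top P Q)]
      with x hx h0 h1
    have h2 : 0 < (P.rnDeriv Q x).toReal := ENNReal.toReal_pos h0.ne' h1.ne
    rw [llr, Real.exp_sub, Real.exp_log (by exact_mod_cast hx), Real.exp_log h2,
      ENNReal.ofReal_div_of_pos h2, ENNReal.ofReal_toReal h1.ne, ENNReal.ofReal_coe_nnreal]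
  have hm : Measurable (P.rnDeriv Q) := Measure.measurable_rnDeriv P Q
  have hP : P = Q.withDensity (P.rnDeriv Q) := (Measure.withDensity_rnDeriv_eq P Q hac).symm
  rw [lintegral_congr_ae hD]
  -- With `P = D • Q`, the integrand `f / D` against `P` becomes `D * (f / D) ≤ f` against `Q`.
  generalize P.rnDeriv Q = D at hm hP
  rw [hP, lintegral_withDensity_eq_lintegral_mul _ hm (by fun_prop)]
  exact (lintegral_mono fun x => ENNReal.mul_div_le).trans hQ

lemma neg_log_measureReal_nonneg {α : Type*} [MeasurableSpace α] (p : Measure α)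
    [IsProbabilityMeasure p] (x : α) :
    0 ≤ -Real.log (p.real {x}) := by
  have := Real.log_nonpos measureReal_nonneg (measureReal_le_one (μ := p) (s := {x}))
  linarith

section Atomic

variable {α : Type*} [MeasurableSpace α] [MeasurableSingletonClass α]

lemma countable_setOf_measure_singleton_ne_zero (p : Measure α) [IsFiniteMeasure p] :
    {x | p {x} ≠ 0}.Countable := by
  have := Measure.countable_meas_pos_of_disjoint_iUnion (μ := p) (As := fun x : α => {x})
    (fun x => measurableSet_singleton x) (fun x y h => by simpa using h)
  simpa [pos_iff_ne_zero] using this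

lemma measurable_measure_singleton (p : Measure α) [IsFiniteMeasure p] :
    Measurable fun x => p {x} := by
  refine (measurable_const (a := (0 : ℝ≥0∞))).measurable_of_countable_ne ?_
  simpa [eq_comm] using countable_setOf_measure_singleton_ne_zero p

variable {β : Type*} [MeasurableSpace β]

/-- A joint law with an atomic first marginal is bounded, up to the factor `1 / p(x)`, by the
product of its marginals. -/
lemma le_withDensity_prod_of_atomic (P : Measure (α × β)) [IsProbabilityMeasure P]
    (hatom : ∀ᵐ x ∂P.fst, P.fst {x} ≠ 0) :
    P ≤ (P.fst.prod P.snd).withDensity fun q => (P.fst {q.1})⁻¹ := by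
  set S := {x | P.fst {x} ≠ 0}
  have hS : S.Countable := countable_setOf_measure_singleton_ne_zero P.fst
  have hm : Measurable fun q : α × β => (P.fst {q.1})⁻¹ :=
    ((measurable_measure_singleton P.fst).comp measurable_fst).inv
  refine Measure.le_intro fun A hA _ => ?_
  have hcover : P A ≤ ∑' x : S, P (A ∩ Prod.fst ⁻¹' {(x : α)}) := by
    have : Countable S := hS.to_subtype
    refine le_trans ?_ (measure_iUnion_le _)
    refine measure_mono_ae ?_
    have h : ∀ᵐ q ∂P, q.1 ∈ S := ae_of_ae_map measurable_fst.aemeasurable hatom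
    filter_upwards [h] with q hq hqA
    exact Set.mem_iUnion.2 ⟨⟨q.1, hq⟩, hqA, rfl⟩
  have hdisj : (∑' x : S, ((P.fst.prod P.snd).withDensity fun q => (P.fst {q.1})⁻¹)
      (A ∩ Prod.fst ⁻¹' {(x : α)})) ≤
      ((P.fst.prod P.snd).withDensity fun q => (P.fst {q.1})⁻¹) A := by
    have : Countable S := hS.to_subtype
    rw [← measure_iUnion]
    · exact measure_mono (Set.iUnion_subset fun x => Set.inter_subset_left)
    · intro x y hxy
      refine Set.disjoint_left.2 fun q hx hy => hxy (Subtype.ext ?_)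
      exact hx.2.symm.trans hy.2
    · exact fun x => hA.inter (measurable_fst (measurableSet_singleton _))
  -- On the slice over an atom `x` the weight `1 / p(x)` cancels the mass of `x`, leaving the second
  -- marginal of the section, which dominates `P` on the slice.
  refine hcover.trans (le_trans (ENNReal.tsum_le_tsum fun x => ?_) hdisj)
  have hmeas : MeasurableSet (A ∩ Prod.fst ⁻¹' {(x : α)}) :=
    hA.inter (measurable_fst (measurableSet_singleton _))
  rw [withDensity_apply _ hmeas]
  have hB : MeasurableSet (Prod.mk (x : α) ⁻¹' A) := measurable_prodMk_left hA
  have heq : A ∩ Prod.fst ⁻¹' {(x : α)} = {(x : α)} ×ˢ (Prod.mk (x : α) ⁻¹' A) := by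
    ext ⟨a, b⟩
    simp only [Set.mem_inter_iff, Set.mem_preimage, Set.mem_singleton_iff, Set.mem_prod]
    constructor
    · rintro ⟨h, rfl⟩; exact ⟨rfl, h⟩
    · rintro ⟨rfl, h⟩; exact ⟨h, rfl⟩
  have hconst : ∫⁻ q in A ∩ Prod.fst ⁻¹' {(x : α)}, (P.fst {q.1})⁻¹ ∂(P.fst.prod P.snd) =
      ∫⁻ q in A ∩ Prod.fst ⁻¹' {(x : α)}, (P.fst {(x : α)})⁻¹ ∂(P.fst.prod P.snd) :=
    setLIntegral_congr_fun hmeas fun q hq => by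
      have : q.1 = x := hq.2
      simp only [this]
  rw [hconst, setLIntegral_const, heq, Measure.prod_prod, ← mul_assoc,
    ENNReal.inv_mul_cancel x.2 (measure_ne_top _ _), one_mul, Measure.snd_apply hB]
  exact measure_mono fun q hq => hq.2

/-- For an atomic first marginal of finite entropy, the mutual information is attained by the
expected logarithm of a density that is subnormalized for every value of the second variable. -/
lemma exists_density_of_atomic (P : Measure (α × β)) [IsProbabilityMeasure P]
    (hatom : ∀ᵐ x ∂P.fst, P.fst {x} ≠ 0)
    (hH : Integrable (fun x => Real.log (P.fst.real {x})) P.fst) :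
    ∃ f : α × β → ℝ≥0, Measurable f ∧
      P = (P.fst.prod P.snd).withDensity (fun q => (f q : ℝ≥0∞)) ∧
      (∀ y, ∫⁻ x, f (x, y) ∂P.fst ≤ 1) ∧
      Integrable (fun q => Real.log (f q)) P ∧
      InformationTheory.klDiv P (P.fst.prod P.snd) = ENNReal.ofReal (∫ q, Real.log (f q) ∂P) := by
  set Q := P.fst.prod P.snd with hQ
  have hle := le_withDensity_prod_of_atomic P hatom
  have hac : P ≪ Q := hle.absolutelyContinuous.trans (withDensity_absolutelyContinuous _ _)
  have hmD : Measurable (P.rnDeriv Q) := Measure.measurable_rnDeriv P Q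
  have hDtop : ∀ᵐ q ∂Q, P.rnDeriv Q q < ∞ := Measure.rnDeriv_lt_top P Q
  have hDle : ∀ᵐ q ∂Q, P.rnDeriv Q q ≤ (P.fst {q.1})⁻¹ := by
    refine ae_le_of_forall_setLIntegral_le_of_sigmaFinite hmD fun s hs _ => ?_
    rw [Measure.setLIntegral_rnDeriv hac, ← withDensity_apply _ hs]
    exact hle s
  have hatomQ : ∀ᵐ q ∂Q, P.fst {q.1} ≠ 0 :=
    Measure.quasiMeasurePreserving_fst.ae hatom
  -- The density `u` is at most `1 / p(x)`, so `u log u + 1 - u ≤ u (-log p(x)) + 1`; integrating,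
  -- the divergence is at most the entropy plus `1`.
  have hkl : InformationTheory.klDiv P Q ≠ ∞ := by
    rw [InformationTheory.klDiv_eq_lintegral_klFun_of_ac hac]
    have hb : ∀ᵐ q ∂Q, ENNReal.ofReal (InformationTheory.klFun (P.rnDeriv Q q).toReal) ≤
        P.rnDeriv Q q * ENNReal.ofReal (-Real.log (P.fst.real {q.1})) + 1 := by
      filter_upwards [hDtop, hDle, hatomQ] with q h1 h2 h3
      have hp : 0 < P.fst.real {q.1} := ENNReal.toReal_pos h3 (measure_ne_top _ _)
      have hu : 0 ≤ (P.rnDeriv Q q).toReal := ENNReal.toReal_nonneg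
      have hu2 : (P.rnDeriv Q q).toReal ≤ (P.fst.real {q.1})⁻¹ := by
        rw [Measure.real, ← ENNReal.toReal_inv]
        exact ENNReal.toReal_mono (ENNReal.inv_ne_top.2 h3) h2
      nth_rw 2 [← ENNReal.ofReal_toReal h1.ne]
      rw [← ENNReal.ofReal_mul hu, ← ENNReal.ofReal_one,
        ← ENNReal.ofReal_add (mul_nonneg hu (neg_log_measureReal_nonneg _ _)) zero_le_one]
      refine ENNReal.ofReal_le_ofReal ?_
      rw [InformationTheory.klFun]
      rcases hu.eq_or_lt with h0 | h0
      · rw [← h0]; simp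
      · have := Real.log_le_log h0 hu2
        rw [Real.log_inv] at this
        nlinarith
    refine ne_top_of_le_ne_top ?_ (lintegral_mono_ae hb)
    have hm2 : Measurable fun q : α × β => ENNReal.ofReal (-Real.log (P.fst.real {q.1})) :=
      (Real.measurable_log.comp
        ((measurable_measure_singleton P.fst).comp measurable_fst).ennreal_toReal).neg.ennreal_ofReal
    rw [lintegral_add_right _ measurable_const, lintegral_rnDeriv_mul hac hm2.aemeasurable]
    refine ENNReal.add_ne_top.2 ⟨?_, by simp⟩
    have hmap : ∫⁻ q, ENNReal.ofReal (-Real.log (P.fst.real {q.1})) ∂P =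
        ∫⁻ x, ENNReal.ofReal (-Real.log (P.fst.real {x})) ∂P.fst := by
      conv_rhs => rw [Measure.fst]
      rw [lintegral_map _ measurable_fst]
      · rfl
      · exact (Real.measurable_log.comp
          (measurable_measure_singleton P.fst).ennreal_toReal).neg.ennreal_ofReal
    rw [hmap]
    have hneg : Integrable (fun x => -Real.log (P.fst.real {x})) P.fst := hH.neg
    exact hneg.lintegral_lt_top.ne
  obtain ⟨-, hllr⟩ := InformationTheory.klDiv_ne_top_iff.1 hkl
  have hmarg : ∀ᵐ y ∂P.snd, ∫⁻ x, P.rnDeriv Q (x, y) ∂P.fst = 1 := by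
    have hm : Measurable fun y => ∫⁻ x, P.rnDeriv Q (x, y) ∂P.fst := hmD.lintegral_prod_left'
    refine ae_eq_of_forall_setLIntegral_eq_of_sigmaFinite hm measurable_const fun s hs _ => ?_
    rw [lintegral_one, Measure.restrict_apply_univ, Measure.snd_apply hs]
    have : P (Prod.snd ⁻¹' s) = ∫⁻ q in Prod.snd ⁻¹' s, P.rnDeriv Q q ∂Q :=
      (Measure.setLIntegral_rnDeriv hac _).symm
    rw [this, ← Set.univ_prod, hQ, ← Measure.prod_restrict, Measure.restrict_univ,
      lintegral_prod_symm' _ hmD]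
  classical
  -- The density is normalized in `x` only for almost every `y`. Zeroing it at the other `y` gives
  -- the bound everywhere, which matters later: `f` gets evaluated at vectors whose law need not be
  -- dominated by that of the second variable.
  let G : Set β := {y | ∫⁻ x, P.rnDeriv Q (x, y) ∂P.fst = 1}
  have hG : MeasurableSet G := hmD.lintegral_prod_left' (measurableSet_singleton 1)
  let f : α × β → ℝ≥0 := fun q => if q.2 ∈ G then (P.rnDeriv Q q).toNNReal else 0
  have hf : Measurable f :=
    Measurable.ite (measurable_snd hG) hmD.ennreal_toNNReal measurable_const
  have hfD : ∀ᵐ q ∂Q, (f q : ℝ≥0∞) = P.rnDeriv Q q := by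
    have : ∀ᵐ q ∂Q, q.2 ∈ G := Measure.quasiMeasurePreserving_snd.ae hmarg
    filter_upwards [this, hDtop] with q h1 h2
    simp only [f, h1, if_true]
    exact ENNReal.coe_toNNReal h2.ne
  have hflog : (fun q => Real.log (f q)) =ᵐ[P] llr P Q := by
    filter_upwards [hac.ae_le hfD] with q hq
    rw [llr, ← hq, ENNReal.coe_toReal]
  refine ⟨f, hf, ?_, fun y => ?_, hllr.congr hflog.symm, ?_⟩
  · rw [withDensity_congr_ae hfD, Measure.withDensity_rnDeriv_eq P Q hac]
  · by_cases hy : y ∈ G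
    · calc ∫⁻ x, f (x, y) ∂P.fst ≤ ∫⁻ x, P.rnDeriv Q (x, y) ∂P.fst :=
          lintegral_mono fun x => by
            simp only [f, hy, if_true]; exact ENNReal.coe_toNNReal_le_self
        _ = 1 := hy
        _ ≤ 1 := le_rfl
    · simp [f, hy]
  · rw [InformationTheory.klDiv_of_ac_of_integrable hac hllr, integral_congr_ae hflog]
    simp

end Atomic

/-- The mutual information dominates the expected logarithm of every subnormalized test function. -/
lemma ofReal_integral_log_le_mutualInfo {Ω α β : Type*} [MeasurableSpace Ω] [MeasurableSpace α]
    [MeasurableSpace β] {μ : Measure Ω} [IsProbabilityMeasure μ] {X : Ω → α} {Y : Ω → β}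
    (hX : Measurable X) (hY : Measurable Y) {f : α × β → ℝ≥0} (hf : Measurable f)
    (hf1 : ∀ᵐ y ∂(μ.map Y), ∫⁻ x, f (x, y) ∂(μ.map X) ≤ 1)
    (hpos : ∀ᵐ ω ∂μ, 0 < f (X ω, Y ω))
    (hint : Integrable (fun ω => Real.log (f (X ω, Y ω))) μ) :
    ENNReal.ofReal (∫ ω, Real.log (f (X ω, Y ω)) ∂μ) ≤ mutualInfo μ X Y := by
  have hXY : Measurable fun ω => (X ω, Y ω) := hX.prodMk hY
  have : IsProbabilityMeasure (μ.map fun ω => (X ω, Y ω)) :=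
    Measure.isProbabilityMeasure_map hXY.aemeasurable
  have : IsProbabilityMeasure (μ.map X) := Measure.isProbabilityMeasure_map hX.aemeasurable
  have : IsProbabilityMeasure (μ.map Y) := Measure.isProbabilityMeasure_map hY.aemeasurable
  have hlog : Measurable fun q => Real.log (f q) := hf.coe_nnreal_real.log
  rw [← integral_map (φ := fun ω => (X ω, Y ω)) (f := fun q => Real.log (f q)) hXY.aemeasurable
    hlog.aestronglyMeasurable]
  refine ofReal_integral_log_le_klDiv hf ?_ ?_ ?_
  · rw [lintegral_prod_symm' _ hf.coe_nnreal_ennreal]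
    calc _ ≤ ∫⁻ _, 1 ∂(μ.map Y) := lintegral_mono_ae hf1
      _ = 1 := by simp
  · rw [ae_map_iff hXY.aemeasurable (measurableSet_lt measurable_const hf)]
    exact hpos
  · rw [integrable_map_measure hlog.aestronglyMeasurable hXY.aemeasurable]
    exact hint

/-- For `X` atomic of finite entropy, the mutual information is attained by a test function. -/
lemma exists_mutualInfo_eq {Ω α β : Type*} [MeasurableSpace Ω] [MeasurableSpace α]
    [MeasurableSingletonClass α] [MeasurableSpace β] {μ : Measure Ω} [IsProbabilityMeasure μ]
    {X : Ω → α} {Y : Ω → β} (hX : Measurable X) (hY : Measurable Y)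
    (hatom : ∀ᵐ x ∂(μ.map X), μ.map X {x} ≠ 0)
    (hH : Integrable (fun x => Real.log ((μ.map X).real {x})) (μ.map X)) :
    ∃ f : α × β → ℝ≥0, Measurable f ∧
      μ.map (fun ω => (X ω, Y ω)) =
        ((μ.map X).prod (μ.map Y)).withDensity (fun q => (f q : ℝ≥0∞)) ∧
      (∀ y, ∫⁻ x, f (x, y) ∂(μ.map X) ≤ 1) ∧
      (∀ᵐ ω ∂μ, 0 < f (X ω, Y ω)) ∧
      Integrable (fun ω => Real.log (f (X ω, Y ω))) μ ∧
      mutualInfo μ X Y = ENNReal.ofReal (∫ ω, Real.log (f (X ω, Y ω)) ∂μ) := by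
  have hXY : Measurable fun ω => (X ω, Y ω) := hX.prodMk hY
  have : IsProbabilityMeasure (μ.map fun ω => (X ω, Y ω)) :=
    Measure.isProbabilityMeasure_map hXY.aemeasurable
  have h1 : (μ.map fun ω => (X ω, Y ω)).fst = μ.map X := Measure.fst_map_prodMk hY
  have h2 : (μ.map fun ω => (X ω, Y ω)).snd = μ.map Y := Measure.snd_map_prodMk hX
  obtain ⟨f, hf, hP, hle, hint, hkl⟩ :=
    exists_density_of_atomic (μ.map fun ω => (X ω, Y ω)) (by rwa [h1]) (by rwa [h1])
  rw [h1, h2] at hP hkl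
  rw [h1] at hle
  have hlog : Measurable fun q => Real.log (f q) := hf.coe_nnreal_real.log
  refine ⟨f, hf, hP, hle, ?_, ?_, ?_⟩
  · have : ∀ᵐ q ∂(μ.map fun ω => (X ω, Y ω)), 0 < f q := by
      rw [hP, ae_withDensity_iff hf.coe_nnreal_ennreal]
      exact ae_of_all _ fun q hq => pos_iff_ne_zero.2 (by simpa using hq)
    exact ae_of_ae_map hXY.aemeasurable this
  · exact (integrable_map_measure hlog.aestronglyMeasurable hXY.aemeasurable).1 hint
  · rw [mutualInfo, hkl, integral_map hXY.aemeasurable hlog.aestronglyMeasurable]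

/-- The measure lives on its countably many atoms, so the integral of `-log p` is the convergent
entropy series. -/
lemma FiniteEntropy.integrable_log {α : Type*} [MeasurableSpace α] [MeasurableSingletonClass α]
    {p : Measure α} [IsProbabilityMeasure p] (h : FiniteEntropy p) :
    Integrable (fun x => Real.log (p.real {x})) p := by
  have hm : Measurable fun x => Real.log (p.real {x}) :=
    (measurable_measure_singleton p).ennreal_toReal.log
  have hS : {x | p {x} ≠ 0}.Countable := countable_setOf_measure_singleton_ne_zero p
  have hr : p.restrict {x | p {x} ≠ 0} = p := Measure.restrict_eq_self_of_ae_mem h.1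
  rw [← integrable_neg_iff]
  refine (lintegral_ofReal_ne_top_iff_integrable hm.neg.aestronglyMeasurable
    (ae_of_all _ fun x => neg_log_measureReal_nonneg p x)).1 ?_
  rw [← hr, lintegral_countable _ hS, hr]
  have hs : Summable fun x : {x | p {x} ≠ 0} => Real.negMulLog (p.real {(x : α)}) :=
    h.2.comp_injective Subtype.val_injective
  have heq : ∀ x : {x | p {x} ≠ 0}, ENNReal.ofReal (-Real.log (p.real {(x : α)})) * p {(x : α)} =
      ENNReal.ofReal (Real.negMulLog (p.real {(x : α)})) := fun x => by
    rw [← ofReal_measureReal (μ := p) (s := {(x : α)}),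
      ← ENNReal.ofReal_mul (neg_log_measureReal_nonneg p _), Real.negMulLog]
    ring_nf
  simp only [Pi.neg_apply, heq]
  exact hs.tsum_ofReal_ne_top

/-! ### Product laws -/

section Pi

variable {α : Type*} [MeasurableSpace α] {n : ℕ}

lemma ae_pi_of_ae {p : Measure α} [IsProbabilityMeasure p] {P : α → Prop} (h : ∀ᵐ x ∂p, P x) :
    ∀ᵐ x ∂(Measure.pi fun _ : Fin n => p), ∀ i, P (x i) :=
  ae_all_iff.2 fun i => (Measure.quasiMeasurePreserving_eval _ i).ae h

lemma lintegral_pi_prod (p : Measure α) [IsProbabilityMeasure p] (f : Fin n → α → ℝ≥0∞)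
    (hf : ∀ i, Measurable (f i)) :
    ∫⁻ x, ∏ i, f i (x i) ∂(Measure.pi fun _ : Fin n => p) = ∏ i, ∫⁻ x, f i x ∂p := by
  have h := lintegral_prod_eq_prod_lintegral_of_indepFun (μ := Measure.pi fun _ : Fin n => p)
    Finset.univ (fun i x => f i (x i)) (iIndepFun_pi fun i => (hf i).aemeasurable)
    fun i => (hf i).comp (measurable_pi_apply i)
  refine h.trans ?_
  refine Finset.prod_congr rfl fun i _ => ?_
  exact (measurePreserving_eval (fun _ : Fin n => p) i).lintegral_comp (hf i)

lemma pi_singleton_ne_zero {p : Measure α} [IsProbabilityMeasure p] (h : ∀ᵐ x ∂p, p {x} ≠ 0) :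
    ∀ᵐ x ∂(Measure.pi fun _ : Fin n => p), (Measure.pi fun _ : Fin n => p) {x} ≠ 0 := by
  filter_upwards [ae_pi_of_ae h] with x hx
  rw [Measure.pi_singleton]
  exact Finset.prod_ne_zero_iff.2 fun i _ => hx i

lemma integrable_log_pi_singleton {p : Measure α} [IsProbabilityMeasure p]
    (h : ∀ᵐ x ∂p, p {x} ≠ 0) (hint : Integrable (fun x => Real.log (p.real {x})) p) :
    Integrable (fun x => Real.log ((Measure.pi fun _ : Fin n => p).real {x}))
      (Measure.pi fun _ : Fin n => p) := by
  have hs : Integrable (fun x : Fin n → α => ∑ i, Real.log (p.real {x i}))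
      (Measure.pi fun _ : Fin n => p) :=
    integrable_finsetSum _ fun i _ =>
      integrable_comp_eval (μ := fun _ : Fin n => p) (i := i)
        (f := fun x => Real.log (p.real {x})) hint
  refine hs.congr ?_
  filter_upwards [ae_pi_of_ae h] with x hx
  rw [Measure.real, Measure.pi_singleton, ENNReal.toReal_prod, Real.log_prod]
  · rfl
  · exact fun i _ => (ENNReal.toReal_pos (hx i) (measure_ne_top _ _)).ne'

end Pi

/-! ### The single-letter converse -/

lemma map_eval_of_map_pi {Ω α : Type*} [MeasurableSpace Ω] [MeasurableSpace α] {μ : Measure Ω}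
    {p : Measure α} [IsProbabilityMeasure p] {n : ℕ} {X : Fin n → Ω → α}
    (hX : ∀ t, Measurable (X t))
    (hlaw : μ.map (fun ω t => X t ω) = Measure.pi fun _ => p) (t : Fin n) : μ.map (X t) = p := by
  have := Measure.map_map (μ := μ) (measurable_pi_apply (X := fun _ : Fin n => α) t)
    (measurable_pi_lambda _ hX)
  rw [hlaw, (measurePreserving_eval (fun _ : Fin n => p) t).map_eq] at this
  exact this.symm

/-- The single-letter lower bound on the leakage rate of an i.i.d. sequence of input loads. -/
theorem singleLetterLeakage_le {pX : Measure ℝ≥0} [IsProbabilityMeasure pX] (hX : FiniteEntropy pX)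
    {Pavg : ℝ≥0∞} {Ω : Type*} [MeasurableSpace Ω] {μ : Measure Ω} [IsProbabilityMeasure μ] {n : ℕ}
    (hn : n ≠ 0) {X Y : Fin n → Ω → ℝ≥0} (hXm : ∀ t, Measurable (X t))
    (hYm : ∀ t, Measurable (Y t)) (hlaw : μ.map (fun ω t => X t ω) = Measure.pi fun _ => pX)
    (hle : ∀ t, ∀ᵐ ω ∂μ, Y t ω ≤ X t ω)
    (havg : ∑ t, ∫⁻ ω, ENNReal.ofReal ((X t ω : ℝ) - Y t ω) ∂μ ≤ n * Pavg) :
    singleLetterLeakage pX Pavg ⊤ ≤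
      mutualInfo μ (fun ω t => X t ω) (fun ω t => Y t ω) / n := by
  have hn0 : (n : ℝ≥0∞) ≠ 0 := by exact_mod_cast hn
  have hnt : (n : ℝ≥0∞) ≠ ∞ := ENNReal.natCast_ne_top n
  have hXYm : ∀ t, Measurable fun ω => (X t ω, Y t ω) := fun t => (hXm t).prodMk (hYm t)
  have hlawt : ∀ t, μ.map (X t) = pX := map_eval_of_map_pi hXm hlaw
  -- Time-averaged joint law. All `X_t` have law `pX` and the constraints are linear in the joint
  -- law, so disintegrating `P` yields an admissible kernel.
  set P : Measure (ℝ≥0 × ℝ≥0) := (n : ℝ≥0∞)⁻¹ • ∑ t, μ.map fun ω => (X t ω, Y t ω) with hPdef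
  have hPapply : ∀ s, MeasurableSet s →
      P s = (n : ℝ≥0∞)⁻¹ * ∑ t, μ {ω | (X t ω, Y t ω) ∈ s} := fun s hs => by
    simp only [hPdef, Measure.smul_apply, Measure.finsetSum_apply, smul_eq_mul]
    congr 1
    exact Finset.sum_congr rfl fun t _ => Measure.map_apply (hXYm t) hs
  have hPprob : IsProbabilityMeasure P := ⟨by
    rw [hPapply _ MeasurableSet.univ]
    simp [ENNReal.inv_mul_cancel hn0 hnt]⟩
  have hPfst : P.fst = pX := by
    ext s hs
    rw [Measure.fst_apply hs, hPapply _ (measurable_fst hs)]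
    have : ∀ t, μ {ω | (X t ω, Y t ω) ∈ Prod.fst ⁻¹' s} = pX s := fun t => by
      rw [← hlawt t, Measure.map_apply (hXm t) hs]; rfl
    rw [Finset.sum_congr rfl fun t _ => this t]
    simp [← mul_assoc, ENNReal.inv_mul_cancel hn0 hnt]
  have hPint : ∀ g : ℝ≥0 × ℝ≥0 → ℝ≥0∞, Measurable g →
      ∫⁻ q, g q ∂P = (n : ℝ≥0∞)⁻¹ * ∑ t, ∫⁻ ω, g (X t ω, Y t ω) ∂μ := fun g hg => by
    rw [hPdef, lintegral_smul_measure, lintegral_finsetSum_measure, smul_eq_mul]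
    congr 1
    exact Finset.sum_congr rfl fun t _ => lintegral_map hg (hXYm t)
  have hcomp : pX ⊗ₘ P.condKernel = P := by rw [← hPfst]; exact P.disintegrate P.condKernel
  have hPle : ∀ᵐ q ∂P, q.2 ≤ q.1 ∧ ENNReal.ofReal ((q.1 : ℝ) - q.2) ≤ ⊤ := by
    have hms : MeasurableSet {q : ℝ≥0 × ℝ≥0 | q.2 ≤ q.1} :=
      measurableSet_le measurable_snd measurable_fst
    have : ∀ᵐ q ∂P, q.2 ≤ q.1 := by
      rw [ae_iff]
      change P {q | q.2 ≤ q.1}ᶜ = 0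
      rw [hPapply _ hms.compl]
      have : ∀ t, μ {ω | (X t ω, Y t ω) ∈ {q : ℝ≥0 × ℝ≥0 | q.2 ≤ q.1}ᶜ} = 0 := hle
      rw [Finset.sum_congr rfl fun t _ => this t]
      simp
    filter_upwards [this] with q hq using ⟨hq, le_top⟩
  have hPavg : ∫⁻ q, ENNReal.ofReal ((q.1 : ℝ) - q.2) ∂P ≤ Pavg := by
    rw [hPint _ (by fun_prop)]
    calc _ ≤ (n : ℝ≥0∞)⁻¹ * (n * Pavg) := by gcongr
      _ = Pavg := by rw [← mul_assoc, ENNReal.inv_mul_cancel hn0 hnt, one_mul]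
  have hinf : singleLetterLeakage pX Pavg ⊤ ≤ mutualInfo P Prod.fst Prod.snd := by
    have h := iInf₂_le (f := fun (κ : Kernel ℝ≥0 ℝ≥0) (_ : κ ∈ {κ : Kernel ℝ≥0 ℝ≥0 |
      IsMarkovKernel κ ∧
      (∀ᵐ q ∂(pX ⊗ₘ κ), q.2 ≤ q.1 ∧ ENNReal.ofReal ((q.1 : ℝ) - q.2) ≤ ⊤) ∧
      ∫⁻ q, ENNReal.ofReal ((q.1 : ℝ) - q.2) ∂(pX ⊗ₘ κ) ≤ Pavg}) =>
        mutualInfo (pX ⊗ₘ κ) Prod.fst Prod.snd) P.condKernel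
      ⟨inferInstance, by rwa [hcomp], by rwa [hcomp]⟩
    simp only [hcomp] at h
    exact h
  refine hinf.trans ?_
  have hPfst' : P.map Prod.fst = pX := hPfst
  obtain ⟨f, hf, hPf, hf1, hfpos, hfint, hfeq⟩ :=
    exists_mutualInfo_eq (μ := P) measurable_fst measurable_snd
      (by rw [hPfst']; exact hX.1) (by rw [hPfst']; exact hX.integrable_log)
  rw [hPfst'] at hf1
  have hlogm : Measurable fun q => Real.log (f q) := hf.coe_nnreal_real.log
  have hint : ∀ t, Integrable (fun ω => Real.log (f (X t ω, Y t ω))) μ := by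
    have h1 : Integrable (fun q => Real.log (f q)) P := hfint
    rw [hPdef, integrable_smul_measure (ENNReal.inv_ne_zero.2 hnt) (ENNReal.inv_ne_top.2 hn0),
      integrable_finsetSum_measure] at h1
    exact fun t => (integrable_map_measure hlogm.aestronglyMeasurable (hXYm t).aemeasurable).1
      (h1 t (Finset.mem_univ t))
  have hval : ∫ q, Real.log (f (q.1, q.2)) ∂P =
      (n : ℝ)⁻¹ * ∑ t, ∫ ω, Real.log (f (X t ω, Y t ω)) ∂μ := by
    simp only [Prod.mk.eta]
    rw [hPdef, integral_smul_measure, integral_finsetSum_measure]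
    · simp only [ENNReal.toReal_inv, ENNReal.toReal_natCast, smul_eq_mul]
      congr 1
      exact Finset.sum_congr rfl fun t _ =>
        integral_map (hXYm t).aemeasurable hlogm.aestronglyMeasurable
    · exact fun t _ => (integrable_map_measure hlogm.aestronglyMeasurable
        (hXYm t).aemeasurable).2 (hint t)
  have hpos : ∀ t, ∀ᵐ ω ∂μ, 0 < f (X t ω, Y t ω) := by
    intro t
    have hac : μ.map (fun ω => (X t ω, Y t ω)) ≪ P := by
      refine Measure.AbsolutelyContinuous.mk fun s hs h0 => ?_
      rw [hPapply _ hs, mul_eq_zero] at h0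
      rcases h0 with h0 | h0
      · exact absurd h0 (ENNReal.inv_ne_zero.2 hnt)
      · rw [Measure.map_apply (hXYm t) hs]
        exact (Finset.sum_eq_zero_iff.1 h0) t (Finset.mem_univ t)
    exact ae_of_ae_map (hXYm t).aemeasurable (hac.ae_le hfpos)
  -- For fixed `y` the integral of `F` over `pX^n` factors into integrals at most `1`, so `F` is a
  -- valid test function without any knowledge of the law of `Y^n`.
  let F : (Fin n → ℝ≥0) × (Fin n → ℝ≥0) → ℝ≥0 := fun q => ∏ t, f (q.1 t, q.2 t)
  have hF : Measurable F := Finset.measurable_prod _ fun t _ => hf.comp (by fun_prop)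
  have hlogF : (fun ω => Real.log (F (fun t => X t ω, fun t => Y t ω))) =ᵐ[μ]
      fun ω => ∑ t, Real.log (f (X t ω, Y t ω)) := by
    filter_upwards [ae_all_iff.2 hpos] with ω hω
    simp only [F, NNReal.coe_prod]
    exact Real.log_prod fun t _ => by exact_mod_cast (hω t).ne'
  have key := ofReal_integral_log_le_mutualInfo (μ := μ) (X := fun ω t => X t ω)
    (Y := fun ω t => Y t ω) (measurable_pi_lambda _ hXm) (measurable_pi_lambda _ hYm) hF
    (ae_of_all _ fun y => by
      rw [hlaw]
      simp only [F, ENNReal.ofNNReal_finsetProd]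
      rw [lintegral_pi_prod pX (fun t x => (f (x, y t) : ℝ≥0∞)) fun t => by fun_prop]
      exact Finset.prod_le_one' fun t _ => hf1 (y t))
    (by
      filter_upwards [ae_all_iff.2 hpos] with ω hω
      exact Finset.prod_pos fun t _ => hω t)
    ((integrable_finsetSum _ fun t _ => hint t).congr hlogF.symm)
  rw [integral_congr_ae hlogF, integral_finsetSum _ fun t _ => hint t] at key
  rw [ENNReal.le_div_iff_mul_le (Or.inl hn0) (Or.inl hnt), hfeq, hval]
  refine le_trans (le_of_eq ?_) key
  rw [← ENNReal.ofReal_natCast, mul_comm, ← ENNReal.ofReal_mul (Nat.cast_nonneg n), ← mul_assoc,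
    mul_inv_cancel₀ (Nat.cast_ne_zero.2 hn), one_mul]

/-! ### The information cost of revealing loads -/

lemma pi_withDensity {γ : Type*} [MeasurableSpace γ] {n : ℕ} (m : Measure γ)
    [IsProbabilityMeasure m] {f : γ → ℝ≥0∞} (hf : Measurable f)
    [IsProbabilityMeasure (m.withDensity f)] :
    Measure.pi (fun _ : Fin n => m.withDensity f) =
      (Measure.pi fun _ : Fin n => m).withDensity fun v => ∏ i, f (v i) := by
  refine Measure.pi_eq fun s hs => ?_
  rw [withDensity_apply _ (MeasurableSet.univ_pi hs), ← lintegral_indicator (MeasurableSet.univ_pi hs)]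
  have : ∀ v : Fin n → γ, (Set.univ.pi s).indicator (fun v => ∏ i, f (v i)) v =
      ∏ i, (s i).indicator f (v i) := fun v => by
    by_cases hv : v ∈ Set.univ.pi s
    · rw [Set.indicator_of_mem hv]
      exact Finset.prod_congr rfl fun i _ => (Set.indicator_of_mem (hv i trivial) f).symm
    · rw [Set.indicator_of_notMem hv]
      simp only [Set.mem_pi, Set.mem_univ, true_implies, not_forall] at hv
      obtain ⟨i, hi⟩ := hv
      exact (Finset.prod_eq_zero (Finset.mem_univ i) (Set.indicator_of_notMem hi f)).symm
  simp only [this]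
  rw [lintegral_pi_prod m (fun i => (s i).indicator f) fun i => hf.indicator (hs i)]
  exact Finset.prod_congr rfl fun i _ => by
    rw [withDensity_apply _ (hs i), lintegral_indicator (hs i)]

/-- Law on `{true, false}` giving mass `a` to `true`. -/
noncomputable def coinLaw (a : ℝ) : Measure Bool :=
  ENNReal.ofReal a • Measure.dirac true + ENNReal.ofReal (1 - a) • Measure.dirac false

lemma isProbabilityMeasure_coinLaw {a : ℝ} (h0 : 0 ≤ a) (h1 : a ≤ 1) :
    IsProbabilityMeasure (coinLaw a) := ⟨by
  simp only [coinLaw, Measure.add_apply, Measure.smul_apply, measure_univ, smul_eq_mul, mul_one]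
  rw [← ENNReal.ofReal_add h0 (by linarith)]
  simp⟩

/-- Coordinates marked `true` in `z` are overwritten by the values in `z`. -/
def overwrite {n : ℕ} (y : Fin n → ℝ≥0) (z : Fin n → Bool × ℝ≥0) : Fin n → ℝ≥0 :=
  fun t => if (z t).1 = true then (z t).2 else y t

lemma measurable_overwrite {n : ℕ} :
    Measurable fun q : (Fin n → ℝ≥0) × (Fin n → Bool × ℝ≥0) => overwrite q.1 q.2 := by
  refine measurable_pi_lambda _ fun t => Measurable.ite ?_ (by fun_prop) (by fun_prop)
  exact (show Measurable fun q : (Fin n → ℝ≥0) × (Fin n → Bool × ℝ≥0) => (q.2 t).1 by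
    fun_prop) (measurableSet_singleton true)

/-- A single pattern of overwritten coordinates is dominated by the average over all patterns. -/
lemma mul_prod_weight_le_lintegral_overwrite {n : ℕ} {p : Measure ℝ≥0} [IsProbabilityMeasure p]
    {a : ℝ} (h0 : 0 ≤ a) (h1 : a ≤ 1) (G : (Fin n → ℝ≥0) → ℝ≥0∞) (x yh y : Fin n → ℝ≥0)
    (W : Fin n → ℝ≥0∞)
    (h : ∀ t, (y t = x t ∧ W t = ENNReal.ofReal a * p {x t}) ∨
      (y t = yh t ∧ W t = ENNReal.ofReal (1 - a))) :
    G y * ∏ t, W t ≤ ∫⁻ z, G (overwrite yh z) ∂(Measure.pi fun _ => (coinLaw a).prod p) := by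
  have := isProbabilityMeasure_coinLaw h0 h1
  -- In each coordinate, `A` is an event of probability exactly `W t` on which overwriting produces
  -- `y t`: either the coin is `true` and the fresh value hits `x t`, or the coin is `false`.
  have hA : ∀ t, ∃ A : Set (Bool × ℝ≥0), MeasurableSet A ∧ (coinLaw a).prod p A = W t ∧
      ∀ z ∈ A, (if z.1 = true then z.2 else yh t) = y t := by
    intro t
    rcases h t with ⟨hy, hW⟩ | ⟨hy, hW⟩
    · refine ⟨{true} ×ˢ {x t}, (measurableSet_singleton _).prod (measurableSet_singleton _), ?_, ?_⟩
      · rw [Measure.prod_prod, hW]; simp [coinLaw]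
      · rintro ⟨b, c⟩ ⟨hb, hc⟩
        simp_all
    · refine ⟨{false} ×ˢ Set.univ, (measurableSet_singleton _).prod MeasurableSet.univ, ?_, ?_⟩
      · rw [Measure.prod_prod, hW]; simp [coinLaw]
      · rintro ⟨b, c⟩ ⟨hb, hc⟩
        simp_all
  choose A hAm hAW hAy using hA
  calc G y * ∏ t, W t = ∫⁻ _ in Set.univ.pi A, G y ∂(Measure.pi fun _ => (coinLaw a).prod p) := by
        rw [setLIntegral_const, Measure.pi_pi]
        simp only [hAW]
    _ = ∫⁻ z in Set.univ.pi A, G (overwrite yh z) ∂(Measure.pi fun _ => (coinLaw a).prod p) := by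
        refine setLIntegral_congr_fun (MeasurableSet.univ_pi hAm) fun z hz => ?_
        have : overwrite yh z = y := funext fun t => hAy t _ (hz t trivial)
        rw [this]
    _ ≤ _ := setLIntegral_le_lintegral _ _

/-- If `(X_t, Ŷ_t)` are i.i.d. with law `pX ⊗ κ` and `Y_t` equals `X_t` on the event `Θ_t` and `Ŷ_t`
off it, then `I(X^n; Y^n)` exceeds `n I(X; Ŷ)` at most by the cost of describing which of the `X_t`
are revealed, and their values. -/
theorem mutualInfo_le_of_reveal {pX : Measure ℝ≥0} [IsProbabilityMeasure pX]
    (hX : FiniteEntropy pX) (κ : Kernel ℝ≥0 ℝ≥0) [IsMarkovKernel κ] {Ω : Type*}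
    [MeasurableSpace Ω] {μ : Measure Ω} [IsProbabilityMeasure μ] {n : ℕ}
    {X Yh Y : Fin n → Ω → ℝ≥0} (hXm : ∀ t, Measurable (X t)) (hYhm : ∀ t, Measurable (Yh t))
    (hYm : ∀ t, Measurable (Y t))
    (hlaw : μ.map (fun ω t => (X t ω, Yh t ω)) = Measure.pi fun _ => pX ⊗ₘ κ)
    {Θ : Fin n → Set Ω} (hΘ : ∀ t, MeasurableSet (Θ t)) (hYX : ∀ t, ∀ ω ∈ Θ t, Y t ω = X t ω)
    (hYY : ∀ t, ∀ ω ∉ Θ t, Y t ω = Yh t ω) {a : ℝ} (ha0 : 0 < a) (ha1 : a < 1) :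
    mutualInfo μ (fun ω t => X t ω) (fun ω t => Y t ω) ≤
      n * mutualInfo (pX ⊗ₘ κ) Prod.fst Prod.snd +
      ENNReal.ofReal (∑ t, (-Real.log (1 - a) +
        ∫ ω in Θ t, (-Real.log a + -Real.log (pX.real {X t ω})) ∂μ)) := by
  classical
  have hfst : (pX ⊗ₘ κ).map Prod.fst = pX := Measure.fst_compProd pX κ
  have hXYm : ∀ t, Measurable fun ω => (X t ω, Yh t ω) := fun t => (hXm t).prodMk (hYhm t)
  have hlawt : ∀ t, μ.map (fun ω => (X t ω, Yh t ω)) = pX ⊗ₘ κ := map_eval_of_map_pi hXYm hlaw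
  have hlawXt : ∀ t, μ.map (X t) = pX := fun t => by
    have := Measure.map_map (μ := μ) measurable_fst (hXYm t)
    rw [hlawt, hfst] at this
    exact this.symm
  have hlawX : μ.map (fun ω t => X t ω) = Measure.pi fun _ => pX := by
    have hm : Measurable fun v : Fin n → ℝ≥0 × ℝ≥0 => fun t => (v t).1 := by fun_prop
    have h1 := Measure.map_map (μ := μ) hm (measurable_pi_lambda _ hXYm)
    have h2 := Measure.pi_map_pi (μ := fun _ : Fin n => pX ⊗ₘ κ) (f := fun _ q => q.1)
      (fun _ => measurable_fst.aemeasurable)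
    have h3 : (fun ω t => X t ω) =
        (fun v : Fin n → ℝ≥0 × ℝ≥0 => fun t => (v t).1) ∘ fun ω t => (X t ω, Yh t ω) := rfl
    rw [h3, ← h1, hlaw, h2]
    exact congrArg Measure.pi (funext fun _ => hfst)
  obtain ⟨f, hf, hPf, hf1, hfpos, hfint, hfeq⟩ :=
    exists_mutualInfo_eq (μ := pX ⊗ₘ κ) measurable_fst measurable_snd
      (by rw [hfst]; exact hX.1) (by rw [hfst]; exact hX.integrable_log)
  obtain ⟨F, hF, -, hF1, hFpos, hFint, hFeq⟩ :=
    exists_mutualInfo_eq (μ := μ) (X := fun ω t => X t ω) (Y := fun ω t => Y t ω)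
      (measurable_pi_lambda _ hXm) (measurable_pi_lambda _ hYm)
      (by rw [hlawX]; exact pi_singleton_ne_zero hX.1)
      (by rw [hlawX]; exact integrable_log_pi_singleton hX.1 hX.integrable_log)
  rw [hfst] at hPf
  rw [hlawX] at hF1
  simp only [Prod.mk.eta] at hPf hfpos hfint hfeq
  set q := (pX ⊗ₘ κ).map Prod.snd with hq
  have hqprob : IsProbabilityMeasure q := Measure.isProbabilityMeasure_map measurable_snd.aemeasurable
  have hPf : pX ⊗ₘ κ = (pX.prod q).withDensity fun v => (f v : ℝ≥0∞) := by
    rw [← hPf]; exact Measure.map_id'.symm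
  have hlogf : Measurable fun v => Real.log (f v) := hf.coe_nnreal_real.log
  have hlogp : Measurable fun x => Real.log (pX.real {x}) :=
    (measurable_measure_singleton pX).ennreal_toReal.log
  have hft : ∀ t, Integrable (fun ω => Real.log (f (X t ω, Yh t ω))) μ := fun t => by
    refine (integrable_map_measure (f := fun ω => (X t ω, Yh t ω)) hlogf.aestronglyMeasurable
      (hXYm t).aemeasurable).1 ?_
    rw [hlawt]; exact hfint
  have hfval : ∀ t, ∫ ω, Real.log (f (X t ω, Yh t ω)) ∂μ = ∫ v, Real.log (f v) ∂(pX ⊗ₘ κ) :=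
    fun t => by
      rw [← hlawt t, integral_map (hXYm t).aemeasurable hlogf.aestronglyMeasurable]
  have hfpost : ∀ᵐ ω ∂μ, ∀ t, 0 < f (X t ω, Yh t ω) := ae_all_iff.2 fun t => by
    rw [← hlawt t] at hfpos
    exact ae_of_ae_map (hXYm t).aemeasurable hfpos
  have hppos : ∀ᵐ ω ∂μ, ∀ t, pX {X t ω} ≠ 0 := ae_all_iff.2 fun t => by
    have := hX.1
    nth_rw 2 [← hlawXt t] at this
    exact ae_of_ae_map (hXm t).aemeasurable this
  have hpt : ∀ t, Integrable (fun ω => Real.log (pX.real {X t ω})) μ := fun t => by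
    refine (integrable_map_measure (f := X t) (g := fun x => Real.log (pX.real {x}))
      hlogp.aestronglyMeasurable (hXm t).aemeasurable).1 ?_
    rw [hlawXt]; exact hX.integrable_log
  -- The cost `c t` bounds the negative log-probability `-log (W t)` that a random overwriting
  -- imitates slot `t`. The term `-log (1 - a)` is charged on revealed slots too, a harmless
  -- surplus.
  let c : Fin n → Ω → ℝ := fun t ω =>
    -Real.log (1 - a) + (Θ t).indicator (fun ω => -Real.log a + -Real.log (pX.real {X t ω})) ω
  have hbase : ∀ t, Integrable (fun ω => -Real.log a + -Real.log (pX.real {X t ω})) μ := fun t =>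
    (integrable_const _).add (hpt t).neg
  have hcint : ∀ t, Integrable (c t) μ := fun t =>
    (integrable_const _).add ((hbase t).indicator (hΘ t))
  have hcval : ∀ t, ∫ ω, c t ω ∂μ = -Real.log (1 - a) +
      ∫ ω in Θ t, (-Real.log a + -Real.log (pX.real {X t ω})) ∂μ := fun t => by
    simp only [c]
    rw [integral_add (integrable_const _) ((hbase t).indicator (hΘ t)), integral_indicator (hΘ t)]
    simp
  let W : Fin n → Ω → ℝ≥0∞ := fun t ω =>
    if ω ∈ Θ t then ENNReal.ofReal a * pX {X t ω} else ENNReal.ofReal (1 - a)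
  have hWc : ∀ᵐ ω ∂μ, ∀ t, ENNReal.ofReal (Real.exp (-c t ω)) ≤ W t ω := by
    filter_upwards [hppos] with ω hω t
    have hl : Real.log (1 - a) ≤ 0 := Real.log_nonpos (by linarith) (by linarith)
    by_cases h : ω ∈ Θ t
    · have hp : 0 < pX.real {X t ω} := ENNReal.toReal_pos (hω t) (measure_ne_top _ _)
      simp only [c, W, h, if_true, Set.indicator_of_mem]
      rw [← ofReal_measureReal (μ := pX), ← ENNReal.ofReal_mul ha0.le]
      refine ENNReal.ofReal_le_ofReal ?_
      calc _ ≤ Real.exp (Real.log a + Real.log (pX.real {X t ω})) :=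
            Real.exp_le_exp.2 (by linarith)
        _ = _ := by rw [Real.exp_add, Real.exp_log ha0, Real.exp_log hp]
    · simp only [c, W, h, if_false, Set.indicator_of_notMem, not_false_eq_true]
      rw [add_zero, neg_neg, Real.exp_log (by linarith)]
  -- Here the overwriting `z` is independent of the loads, unlike the actual revelations, so
  -- averaging `F` over it keeps the integral in `x` at most `1` for every `y`.
  let Φ : (Fin n → ℝ≥0) × (Fin n → ℝ≥0) → ℝ≥0∞ := fun v =>
    ∫⁻ z, F (v.1, overwrite v.2 z) ∂(Measure.pi fun _ => (coinLaw a).prod pX)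
  have := isProbabilityMeasure_coinLaw ha0.le ha1.le
  have hFo : Measurable fun u : ((Fin n → ℝ≥0) × (Fin n → ℝ≥0)) × (Fin n → Bool × ℝ≥0) =>
      (F (u.1.1, overwrite u.1.2 u.2) : ℝ≥0∞) :=
    (hF.comp ((measurable_fst.comp measurable_fst).prodMk (measurable_overwrite.comp
      ((measurable_snd.comp measurable_fst).prodMk measurable_snd)))).coe_nnreal_ennreal
  have hΦ : Measurable Φ := hFo.lintegral_prod_right'
  have hΦ1 : ∫⁻ v, Φ v ∂((Measure.pi fun _ => pX).prod (Measure.pi fun _ => q)) ≤ 1 := by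
    rw [lintegral_prod_symm' _ hΦ]
    have : ∀ y, ∫⁻ x, Φ (x, y) ∂(Measure.pi fun _ => pX) ≤ 1 := fun y => by
      simp only [Φ]
      rw [lintegral_lintegral_swap]
      · calc _ ≤ ∫⁻ _, 1 ∂(Measure.pi fun _ : Fin n => (coinLaw a).prod pX) :=
            lintegral_mono fun z => hF1 _
          _ = 1 := by simp
      · exact (hFo.comp (by fun_prop : Measurable
          fun u : (Fin n → ℝ≥0) × (Fin n → Bool × ℝ≥0) => ((u.1, y), u.2))).aemeasurable
    calc _ ≤ ∫⁻ _, 1 ∂(Measure.pi fun _ : Fin n => q) := lintegral_mono this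
      _ = 1 := by simp
  -- The true law of `(X^n, Ŷ^n)` has density `∏ f` against `pX^n × q^n`; dividing by it turns the
  -- bound on `Φ` into `E Ψ ≤ 1`.
  let Ψ : (Fin n → ℝ≥0 × ℝ≥0) → ℝ≥0∞ := fun v =>
    Φ (fun t => (v t).1, fun t => (v t).2) / ∏ t, (f (v t) : ℝ≥0∞)
  have hΨ : Measurable Ψ := by
    refine Measurable.div (hΦ.comp (by fun_prop)) ?_
    exact Finset.measurable_prod _ fun t _ => by fun_prop
  have hΨ1 : ∫⁻ ω, Ψ (fun t => (X t ω, Yh t ω)) ∂μ ≤ 1 := by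
    rw [← lintegral_map (f := Ψ) hΨ (measurable_pi_lambda _ hXYm), hlaw]
    have : IsProbabilityMeasure ((pX.prod q).withDensity fun v => (f v : ℝ≥0∞)) := by
      rw [← hPf]; infer_instance
    have hpi := pi_withDensity (n := n) (pX.prod q) hf.coe_nnreal_ennreal
    rw [← hPf] at hpi
    rw [hpi, lintegral_withDensity_eq_lintegral_mul _ _ hΨ]
    · refine le_trans (lintegral_mono (g := fun v : Fin n → ℝ≥0 × ℝ≥0 =>
        Φ (fun t => (v t).1, fun t => (v t).2)) fun v => ENNReal.mul_div_le) ?_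
      exact ((measurePreserving_arrowProdEquivProdArrow ℝ≥0 ℝ≥0 (Fin n) (fun _ => pX)
        (fun _ => q)).lintegral_comp hΦ).le.trans hΦ1
    · exact Finset.measurable_prod _ fun t _ => by fun_prop
  -- Since `F(X, Y) ∏ W ≤ Φ(X, Ŷ)`, `exp g ≤ Ψ` almost surely. Hence `E g ≤ 0`, which is the claimed
  -- inequality between log-likelihoods.
  let g : Ω → ℝ := fun ω => Real.log (F (fun t => X t ω, fun t => Y t ω)) -
    ∑ t, (Real.log (f (X t ω, Yh t ω)) + c t ω)
  have hsumint : Integrable (fun ω => ∑ t, (Real.log (f (X t ω, Yh t ω)) + c t ω)) μ :=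
    integrable_finsetSum _ fun t _ => (hft t).add (hcint t)
  have hgle : ∀ᵐ ω ∂μ, ENNReal.ofReal (Real.exp (g ω)) ≤ Ψ (fun t => (X t ω, Yh t ω)) := by
    filter_upwards [hfpost, hFpos, hWc] with ω h1 h2 h3
    have hexp : Real.exp (g ω) = F (fun t => X t ω, fun t => Y t ω) *
        (∏ t, Real.exp (-c t ω)) / ∏ t, (f (X t ω, Yh t ω) : ℝ) := by
      have hprod : ∏ t, (f (X t ω, Yh t ω) : ℝ) =
          Real.exp (∑ t, Real.log (f (X t ω, Yh t ω))) := by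
        rw [Real.exp_sum]
        exact Finset.prod_congr rfl fun t _ => (Real.exp_log (by exact_mod_cast h1 t)).symm
      have h2' : (0 : ℝ) < F (fun t => X t ω, fun t => Y t ω) := by exact_mod_cast h2
      rw [hprod, ← Real.exp_sum]
      nth_rw 1 [← Real.exp_log h2']
      rw [← Real.exp_add, ← Real.exp_sub]
      simp only [g, Finset.sum_add_distrib, Finset.sum_neg_distrib]
      ring_nf
    have hfp : (0 : ℝ) < ∏ t, (f (X t ω, Yh t ω) : ℝ) :=
      Finset.prod_pos fun t _ => by exact_mod_cast h1 t
    rw [hexp, ENNReal.ofReal_div_of_pos hfp,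
      ENNReal.ofReal_mul NNReal.zero_le_coe, ENNReal.ofReal_coe_nnreal,
      ENNReal.ofReal_prod_of_nonneg fun t _ => (Real.exp_pos _).le,
      ENNReal.ofReal_prod_of_nonneg fun t _ => NNReal.zero_le_coe]
    simp only [ENNReal.ofReal_coe_nnreal, Ψ]
    refine ENNReal.div_le_div_right ?_ _
    calc _ ≤ (F (fun t => X t ω, fun t => Y t ω) : ℝ≥0∞) * ∏ t, W t ω := by
          gcongr with t _; exact h3 t
      _ ≤ _ := mul_prod_weight_le_lintegral_overwrite ha0.le ha1.le
          (fun y => (F (fun t => X t ω, y) : ℝ≥0∞)) (fun t => X t ω) (fun t => Yh t ω)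
          (fun t => Y t ω) (fun t => W t ω) fun t => by
            by_cases h : ω ∈ Θ t
            · exact Or.inl ⟨hYX t ω h, if_pos h⟩
            · exact Or.inr ⟨hYY t ω h, if_neg h⟩
  have hfinal := integral_nonpos_of_lintegral_exp_le_one (hFint.sub hsumint)
    ((lintegral_mono_ae hgle).trans hΨ1)
  have hsplit : ∫ ω, g ω ∂μ = ∫ ω, Real.log (F (fun t => X t ω, fun t => Y t ω)) ∂μ -
      (n * ∫ v, Real.log (f v) ∂(pX ⊗ₘ κ) + ∑ t, (-Real.log (1 - a) +
        ∫ ω in Θ t, (-Real.log a + -Real.log (pX.real {X t ω})) ∂μ)) := by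
    simp only [g]
    have hadd : ∀ t, Integrable (fun ω => Real.log (f (X t ω, Yh t ω)) + c t ω) μ := fun t =>
      (hft t).add (hcint t)
    rw [integral_sub hFint hsumint, integral_finsetSum _ fun t _ => hadd t]
    congr 1
    rw [Finset.sum_congr rfl fun t _ => integral_add (hft t) (hcint t), Finset.sum_add_distrib]
    simp [hfval, hcval]
  have hfinal' : ∫ ω, g ω ∂μ ≤ 0 := hfinal
  rw [hFeq, hfeq, ← ENNReal.ofReal_natCast, ← ENNReal.ofReal_mul (Nat.cast_nonneg n)]
  refine le_trans (ENNReal.ofReal_le_ofReal ?_) ENNReal.ofReal_add_le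
  linarith

/-- The expected part above level `K` of the self-information becomes arbitrarily small. -/
lemma exists_integral_selfInfo_sub_le {p : Measure ℝ≥0} [IsProbabilityMeasure p]
    (h : FiniteEntropy p) {δ : ℝ} (hδ : 0 < δ) :
    ∃ K : ℝ, 0 ≤ K ∧ ∫ x, max (-Real.log (p.real {x}) - K) 0 ∂p ≤ δ := by
  have hm : Measurable fun x => Real.log (p.real {x}) :=
    (measurable_measure_singleton p).ennreal_toReal.log
  have ht : Tendsto (fun k : ℕ => ∫ x, max (-Real.log (p.real {x}) - k) 0 ∂p) atTop
      (𝓝 (∫ _, (0 : ℝ) ∂p)) := by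
    refine tendsto_integral_of_dominated_convergence (fun x => |Real.log (p.real {x})|)
      (fun k => ((hm.neg.sub_const _).max measurable_const).aestronglyMeasurable)
      h.integrable_log.abs (fun k => ae_of_all _ fun x => ?_) (ae_of_all _ fun x => ?_)
    · rw [Real.norm_of_nonneg (le_max_right _ _)]
      refine max_le ?_ (abs_nonneg _)
      have : (0 : ℝ) ≤ k := Nat.cast_nonneg k
      linarith [neg_abs_le (Real.log (p.real {x}))]
    · refine tendsto_const_nhds.congr' ?_
      obtain ⟨N, hN⟩ := exists_nat_ge (-Real.log (p.real {x}))
      filter_upwards [eventually_ge_atTop N] with k hk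
      have : (N : ℝ) ≤ k := by exact_mod_cast hk
      exact (max_eq_right (by linarith)).symm
  rw [integral_zero] at ht
  obtain ⟨k, hk⟩ := (ht.eventually (gt_mem_nhds hδ)).exists
  exact ⟨k, Nat.cast_nonneg k, hk.le⟩

/-- The cost of revealing an input load on a rare event is small. -/
lemma exists_reveal_cost_le {p : Measure ℝ≥0} [IsProbabilityMeasure p] (h : FiniteEntropy p)
    {δ : ℝ} (hδ : 0 < δ) :
    ∃ a : ℝ, 0 < a ∧ a < 1 ∧ ∃ C : ℝ, 0 ≤ C ∧ ∀ {Ω : Type} [MeasurableSpace Ω] {μ : Measure Ω}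
      [IsProbabilityMeasure μ] {X : Ω → ℝ≥0}, Measurable X → μ.map X = p →
      ∀ {Θ : Set Ω}, MeasurableSet Θ →
      -Real.log (1 - a) + ∫ ω in Θ, (-Real.log a + -Real.log (p.real {X ω})) ∂μ ≤
        δ + C * μ.real Θ := by
  obtain ⟨K, hK0, hK⟩ := exists_integral_selfInfo_sub_le h (half_pos hδ)
  -- The choice `a = 1 - exp (-δ/2)` makes `-log (1 - a)` equal to `δ/2`; the tail of the
  -- self-information takes the other half.
  have hexp : Real.exp (-(δ / 2)) < 1 := by
    rw [← Real.exp_zero]; exact Real.exp_lt_exp.2 (by linarith)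
  have ha0 : 0 < 1 - Real.exp (-(δ / 2)) := by linarith
  have ha1 : 1 - Real.exp (-(δ / 2)) < 1 := by linarith [Real.exp_pos (-(δ / 2))]
  refine ⟨1 - Real.exp (-(δ / 2)), ha0, ha1, -Real.log (1 - Real.exp (-(δ / 2))) + K,
    add_nonneg (neg_nonneg.2 (Real.log_nonpos ha0.le ha1.le)) hK0, ?_⟩
  intro Ω _ μ _ X hXm hlaw Θ hΘ
  set la := -Real.log (1 - Real.exp (-(δ / 2)))
  have hm : Measurable fun x => Real.log (p.real {x}) :=
    (measurable_measure_singleton p).ennreal_toReal.log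
  have hint : Integrable (fun ω => Real.log (p.real {X ω})) μ := by
    refine (integrable_map_measure (f := X) (g := fun x => Real.log (p.real {x}))
      hm.aestronglyMeasurable hXm.aemeasurable).1 ?_
    rw [hlaw]; exact h.integrable_log
  have hmax : Integrable (fun ω => max (-Real.log (p.real {X ω}) - K) 0) μ :=
    (hint.neg.sub (integrable_const K)).sup (integrable_const 0)
  have hexc : ∫ ω, max (-Real.log (p.real {X ω}) - K) 0 ∂μ ≤ δ / 2 := by
    refine le_trans (le_of_eq ?_) hK
    have := integral_map (μ := μ) (f := fun x => max (-Real.log (p.real {x}) - K) 0)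
      hXm.aemeasurable ((hm.neg.sub_const K).max measurable_const).aestronglyMeasurable
    rw [hlaw] at this
    exact this.symm
  -- Self-information is at most `K` plus its excess over `K`. The excess is integrated over the
  -- whole space, so no independence of `Θ` and `X` is needed.
  have h1 : ∫ ω in Θ, (la + -Real.log (p.real {X ω})) ∂μ ≤
      ∫ ω in Θ, ((la + K) + max (-Real.log (p.real {X ω}) - K) 0) ∂μ := by
    refine integral_mono (((integrable_const la).add hint.neg).integrableOn)
      (((integrable_const (la + K)).add hmax).integrableOn) fun ω => ?_
    have := le_max_left (-Real.log (p.real {X ω}) - K) 0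
    change la + -Real.log (p.real {X ω}) ≤ (la + K) + max (-Real.log (p.real {X ω}) - K) 0
    linarith
  have h2 : ∫ ω in Θ, ((la + K) + max (-Real.log (p.real {X ω}) - K) 0) ∂μ =
      (la + K) * μ.real Θ + ∫ ω in Θ, max (-Real.log (p.real {X ω}) - K) 0 ∂μ := by
    rw [integral_add (integrable_const _) hmax.integrableOn]
    simp [mul_comm]
  have h3 : ∫ ω in Θ, max (-Real.log (p.real {X ω}) - K) 0 ∂μ ≤ δ / 2 :=
    (setIntegral_le_integral hmax (ae_of_all _ fun ω => le_max_right _ _)).trans hexc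
  have h4 : -Real.log (1 - (1 - Real.exp (-(δ / 2)))) = δ / 2 := by simp
  rw [h4]
  linarith

/-- Per-slot form of the two previous bounds. The constant `C` is fixed before the length, the
policy and the events `Θ`, so the revelation probability can be tuned to it afterwards. -/
lemma exists_leakage_le_of_reveal {pX : Measure ℝ≥0} [IsProbabilityMeasure pX]
    (hX : FiniteEntropy pX) (κ : Kernel ℝ≥0 ℝ≥0) [IsMarkovKernel κ] {δ : ℝ} (hδ : 0 < δ) :
    ∃ C : ℝ, 0 ≤ C ∧ ∀ {Ω : Type} [MeasurableSpace Ω] {μ : Measure Ω} [IsProbabilityMeasure μ]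
      {n : ℕ} {X Yh Y : Fin n → Ω → ℝ≥0} {Θ : Fin n → Set Ω},
      n ≠ 0 → (∀ t, Measurable (X t)) → (∀ t, Measurable (Yh t)) → (∀ t, Measurable (Y t)) →
      μ.map (fun ω t => (X t ω, Yh t ω)) = Measure.pi (fun _ => pX ⊗ₘ κ) →
      (∀ t, MeasurableSet (Θ t)) → (∀ t, ∀ ω ∈ Θ t, Y t ω = X t ω) →
      (∀ t, ∀ ω ∉ Θ t, Y t ω = Yh t ω) →
      mutualInfo μ (fun ω t => X t ω) (fun ω t => Y t ω) / n ≤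
        mutualInfo (pX ⊗ₘ κ) Prod.fst Prod.snd +
          ENNReal.ofReal (δ + C * ((n : ℝ)⁻¹ * ∑ t, μ.real (Θ t))) := by
  obtain ⟨a, ha0, ha1, C, hC, hcost⟩ := exists_reveal_cost_le hX hδ
  refine ⟨C, hC, ?_⟩
  intro Ω _ μ _ n X Yh Y Θ hn hXm hYhm hYm hlaw hΘ hYX hYY
  have hn0 : (n : ℝ≥0∞) ≠ 0 := by exact_mod_cast hn
  have hnt : (n : ℝ≥0∞) ≠ ∞ := ENNReal.natCast_ne_top n
  have hlawXt : ∀ t, μ.map (X t) = pX := fun t => by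
    have h1 := map_eval_of_map_pi (fun t => (hXm t).prodMk (hYhm t)) hlaw t
    have := Measure.map_map (μ := μ) measurable_fst ((hXm t).prodMk (hYhm t))
    rw [h1] at this
    exact this.symm.trans (Measure.fst_compProd pX κ)
  have hmain := mutualInfo_le_of_reveal hX κ hXm hYhm hYm hlaw hΘ hYX hYY ha0 ha1
  refine ENNReal.div_le_of_le_mul (hmain.trans ?_)
  rw [add_mul, mul_comm (n : ℝ≥0∞)]
  gcongr
  rw [← ENNReal.ofReal_natCast, ← ENNReal.ofReal_mul' (Nat.cast_nonneg n)]
  refine ENNReal.ofReal_le_ofReal ?_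
  calc _ ≤ ∑ t, (δ + C * μ.real (Θ t)) :=
        Finset.sum_le_sum fun t _ => hcost (hXm t) (hlawXt t) (hΘ t)
    _ = _ := by
      have : (n : ℝ) ≠ 0 := by exact_mod_cast hn
      rw [Finset.sum_add_distrib, ← Finset.mul_sum]
      simp only [Finset.sum_const, Finset.card_univ, Fintype.card_fin, nsmul_eq_mul]
      field_simp

/-! ### Laws of slotwise functions and randomized kernels -/

lemma map_infinitePi_slotwise {S T : Type*} [MeasurableSpace S] [MeasurableSpace T]
    (m : Measure S) [IsProbabilityMeasure m] {h : S → T} (hh : Measurable h) (n : ℕ) :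
    (Measure.infinitePi fun _ : ℕ => m).map (fun ω (t : Fin n) => h (ω t)) =
      Measure.pi fun _ => m.map h := by
  have hind : iIndepFun (fun (i : ℕ) (ω : ℕ → S) => h (ω i)) (Measure.infinitePi fun _ : ℕ => m) :=
    iIndepFun_infinitePi fun _ => hh
  have h1 := (iIndepFun_iff_map_fun_eq_pi_map (fun i => (hh.comp (measurable_pi_apply _)).aemeasurable)).1
    (hind.precomp (Fin.val_injective (n := n)))
  refine h1.trans ?_
  congr 1
  funext t
  have h2 := Measure.map_map (μ := Measure.infinitePi fun _ : ℕ => m) hh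
    (measurable_pi_apply (t : ℕ))
  rw [Measure.infinitePi_map_eval] at h2
  exact h2.symm

lemma map_prod_eq_compProd {α β : Type*} [MeasurableSpace α] [MeasurableSpace β] (p : Measure α)
    [IsProbabilityMeasure p] (κ : Kernel α β) [IsMarkovKernel κ] {g : α → I → β}
    (hg : Measurable (Function.uncurry g)) (hgκ : ∀ x, (volume : Measure I).map (g x) = κ x) :
    (p.prod (volume : Measure I)).map (fun v => (v.1, g v.1 v.2)) = p ⊗ₘ κ := by
  have hm : Measurable fun v : α × I => (v.1, g v.1 v.2) := measurable_fst.prodMk hg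
  ext s hs
  rw [Measure.map_apply hm hs, Measure.prod_apply (hm hs), Measure.compProd_apply hs]
  refine lintegral_congr fun x => ?_
  have hgx : Measurable (g x) := hg.comp measurable_prodMk_left
  rw [← hgκ x, Measure.map_apply hgx (measurable_prodMk_left hs)]
  rfl

/-! ### Measurability of the systems -/

lemma measurable_finSnoc {Ω β : Type*} [MeasurableSpace Ω] [MeasurableSpace β] {t : ℕ}
    {f : Ω → Fin t → β} {g : Ω → β} (hf : Measurable f) (hg : Measurable g) :
    Measurable fun ω => Fin.snoc (α := fun _ => β) (f ω) (g ω) := by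
  refine measurable_pi_lambda _ fun i => ?_
  induction i using Fin.lastCases with
  | last => simpa using hg
  | cast i => simpa using measurable_pi_iff.1 hf i

lemma measurable_inputLoad (t : ℕ) : Measurable (inputLoad t) := by unfold inputLoad; fun_prop

lemma measurable_harvest (t : ℕ) : Measurable (harvest t) := by unfold harvest; fun_prop

lemma measurable_seed (t : ℕ) : Measurable (seed t) := by unfold seed; fun_prop

lemma Policy.measurable_run (π : Policy) (t : ℕ) : Measurable fun ω => π.run ω t := by
  induction t with
  | zero => exact measurable_const
  | succ t ih =>
    have hy : Measurable fun ω => (π.run ω t).1 := measurable_fst.comp ih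
    have hs : Measurable fun ω => (π.run ω t).2 := measurable_snd.comp ih
    have hx : Measurable fun (ω : Outcome) (i : Fin (t + 1)) => inputLoad i ω :=
      measurable_pi_lambda _ fun i => measurable_inputLoad i
    have ha : Measurable fun ω => π.alloc t (seed t ω, fun i => inputLoad i ω, (π.run ω t).1,
        (π.run ω t).2, harvest t ω) :=
      (π.measurable_alloc t).comp ((measurable_seed t).prodMk
        (hx.prodMk (hy.prodMk (hs.prodMk (measurable_harvest t)))))
    refine (measurable_finSnoc hy ha).prodMk (measurable_finSnoc hs ?_)
    unfold nextBattery
    have h1 := measurable_harvest t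
    have h2 := measurable_inputLoad t
    have h3 : Measurable fun ω => (π.run ω t).2 (Fin.last t) := (measurable_pi_apply _).comp hs
    fun_prop

lemma Policy.measurable_output (π : Policy) (t : ℕ) : Measurable (π.output t) :=
  (measurable_pi_apply _).comp (measurable_fst.comp (π.measurable_run (t + 1)))

lemma PowerPolicy.measurable_run (π : PowerPolicy) (t : ℕ) : Measurable fun ω => π.run ω t := by
  induction t with
  | zero => exact measurable_const
  | succ t ih =>
    refine measurable_finSnoc ih ((π.measurable_alloc t).comp ?_)
    have hx : Measurable fun (ω : PowerOutcome) (i : Fin (t + 1)) => (ω i).1 := by fun_prop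
    have hu : Measurable fun ω : PowerOutcome => (ω t).2 := by fun_prop
    exact hu.prodMk (hx.prodMk ih)

lemma PowerPolicy.measurable_output (π : PowerPolicy) (t : ℕ) : Measurable (π.output t) :=
  (measurable_pi_apply _).comp (π.measurable_run (t + 1))

lemma PowerPolicy.output_eq (π : PowerPolicy) (t : ℕ) (ω : PowerOutcome) :
    π.output t ω = π.alloc t ((ω t).2, fun i => (ω i).1, π.run ω t) := by
  simp [PowerPolicy.output, PowerPolicy.run]

instance (pX pE : Measure ℝ≥0) [IsProbabilityMeasure pX] [IsProbabilityMeasure pE] :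
    IsProbabilityMeasure (outcomeLaw pX pE) := by unfold outcomeLaw; infer_instance

instance (pX : Measure ℝ≥0) [IsProbabilityMeasure pX] :
    IsProbabilityMeasure (powerOutcomeLaw pX) := by unfold powerOutcomeLaw; infer_instance

lemma map_harvest (pX pE : Measure ℝ≥0) [IsProbabilityMeasure pX] [IsProbabilityMeasure pE]
    (t : ℕ) : (outcomeLaw pX pE).map (harvest t) = pE := by
  have h1 : (outcomeLaw pX pE).map (fun ω => ω t) = pX.prod (pE.prod (volume : Measure I)) :=
    Measure.infinitePi_map_eval (fun _ : ℕ => pX.prod (pE.prod (volume : Measure I))) t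
  have h2 := Measure.map_map (μ := outcomeLaw pX pE)
    (measurable_fst.comp measurable_snd : Measurable fun v : ℝ≥0 × ℝ≥0 × I => v.2.1)
    (measurable_pi_apply t)
  have h3 : (pX.prod (pE.prod (volume : Measure I))).map (fun v => v.2.1) = pE := by
    have := Measure.map_map (μ := pX.prod (pE.prod (volume : Measure I)))
      (measurable_fst : Measurable (Prod.fst : ℝ≥0 × I → ℝ≥0)) measurable_snd
    rw [Measure.map_snd_prod, measure_univ, one_smul, Measure.map_fst_prod, measure_univ,
      one_smul] at this
    exact this.symm
  rw [h1] at h2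
  exact h2.symm.trans h3

/-! ### Lower bounds -/

/-- Of the cumulative energy constraints only the last, `k = n`, is used: its expectation is the
average power constraint with budget `E[E_t]`. -/
lemma singleLetterLeakage_le_leakageRate {pX pE : Measure ℝ≥0} [IsProbabilityMeasure pX]
    [IsProbabilityMeasure pE] (hX : FiniteEntropy pX) {n : ℕ} (hn : n ≠ 0) {π : Policy}
    (hπ : π.Feasible pX pE n) :
    singleLetterLeakage pX (∫⁻ e, (e : ℝ≥0∞) ∂pE) ⊤ ≤ π.leakageRate pX pE n := by
  refine singleLetterLeakage_le (X := fun (t : Fin n) => inputLoad t)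
    (Y := fun (t : Fin n) => π.output t) hX hn (fun t => measurable_inputLoad t)
    (fun t => π.measurable_output t) ?_ (fun t => ?_) ?_
  · refine (map_infinitePi_slotwise (pX.prod (pE.prod (volume : Measure I))) measurable_fst n).trans ?_
    simp [Measure.map_fst_prod]
  · filter_upwards [hπ] with ω hω using hω.1 t t.2
  · have hm : ∀ t, Measurable fun ω =>
        ENNReal.ofReal ((inputLoad t ω : ℝ) - π.output t ω) := fun t => by
      have h1 := measurable_inputLoad t
      have h2 := π.measurable_output t
      fun_prop
    rw [← lintegral_finsetSum _ fun (t : Fin n) _ => hm t]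
    calc _ ≤ ∫⁻ ω, ∑ t ∈ Finset.range n, (harvest t ω : ℝ≥0∞) ∂(outcomeLaw pX pE) := by
          refine lintegral_mono_ae ?_
          filter_upwards [hπ] with ω hω
          rw [Fin.sum_univ_eq_sum_range
            (fun t => ENNReal.ofReal ((inputLoad t ω : ℝ) - π.output t ω)) n,
            ← ENNReal.ofReal_sum_of_nonneg fun t ht => sub_nonneg.2
              (NNReal.coe_le_coe.2 (hω.1 t (Finset.mem_range.1 ht)))]
          refine (ENNReal.ofReal_le_ofReal (hω.2 n le_rfl)).trans_eq ?_
          rw [ENNReal.ofReal_sum_of_nonneg fun _ _ => NNReal.zero_le_coe]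
          simp
      _ = _ := by
          rw [lintegral_finsetSum _ fun t _ => (measurable_harvest t).coe_nnreal_ennreal]
          have : ∀ t, ∫⁻ ω, (harvest t ω : ℝ≥0∞) ∂(outcomeLaw pX pE) =
              ∫⁻ e, (e : ℝ≥0∞) ∂pE := fun t => by
            rw [← lintegral_map (f := fun e : ℝ≥0 => (e : ℝ≥0∞)) measurable_coe_nnreal_ennreal
              (measurable_harvest t), map_harvest]
          simp [this]

lemma singleLetterLeakage_le_power_leakageRate {pX : Measure ℝ≥0} [IsProbabilityMeasure pX]
    (hX : FiniteEntropy pX) {Pavg : ℝ≥0∞} {n : ℕ} (hn : n ≠ 0) {π : PowerPolicy}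
    (hπ : π.Feasible pX Pavg ⊤ n) :
    singleLetterLeakage pX Pavg ⊤ ≤ π.leakageRate pX n := by
  have hn0 : (n : ℝ≥0∞) ≠ 0 := by exact_mod_cast hn
  have hnt : (n : ℝ≥0∞) ≠ ∞ := ENNReal.natCast_ne_top n
  refine singleLetterLeakage_le (X := fun (t : Fin n) (ω : PowerOutcome) => (ω t).1)
    (Y := fun (t : Fin n) => π.output t) hX hn (fun t => by fun_prop)
    (fun t => π.measurable_output t) ?_ (fun t => ?_) ?_
  · refine (map_infinitePi_slotwise (pX.prod (volume : Measure I)) measurable_fst n).trans ?_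
    simp [Measure.map_fst_prod]
  · filter_upwards [hπ.1] with ω hω using (hω t t.2).1
  · have hm : ∀ t, Measurable fun ω : PowerOutcome =>
        ENNReal.ofReal (((ω t).1 : ℝ) - π.output t ω) := fun t => by
      have h2 := π.measurable_output t
      fun_prop
    have h := hπ.2
    simp only [div_eq_mul_inv] at h
    rw [lintegral_mul_const _ (Finset.measurable_sum _ fun t _ => hm t), ← div_eq_mul_inv,
      ENNReal.div_le_iff hn0 hnt, mul_comm] at h
    rw [← lintegral_finsetSum _ fun (t : Fin n) _ => hm t]
    refine le_trans (le_of_eq (lintegral_congr fun ω => ?_)) h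
    exact Fin.sum_univ_eq_sum_range (fun t => ENNReal.ofReal (((ω t).1 : ℝ) - π.output t ω)) n

/-! ### From near-optimal rates to limits -/

/-- Near-optimal policies of each length give a sequence whose values converge to the bound. -/
lemma exists_seq_tendsto {A : Type*} {good : ℕ → A → Prop} {val : ℕ → A → ℝ≥0∞} {L : ℝ≥0∞}
    (hne : ∀ n, ∃ π, good n π) (hlow : ∀ n ≠ 0, ∀ π, good n π → L ≤ val n π)
    (hup : ∀ r > L, ∀ᶠ n in atTop, ∃ π, good n π ∧ val n π ≤ r) :
    ∃ π : ℕ → A, (∀ n, good n (π n)) ∧ Tendsto (fun n => val n (π n)) atTop (𝓝 L) := by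
  -- Pick a minimizer up to `1/n` at each length, so that one sequence serves all `r > L` at once.
  -- At `n = 0` the tolerance is `∞`.
  have hsel : ∀ n, ∃ π, good n π ∧
      val n π ≤ (⨅ b ∈ {b | good n b}, val n b) + (n : ℝ≥0∞)⁻¹ := by
    intro n
    by_cases htop : (⨅ b ∈ {b | good n b}, val n b) = ∞
    · obtain ⟨π, hπ⟩ := hne n
      exact ⟨π, hπ, by rw [htop]; simp⟩
    · have hlt : (⨅ b ∈ {b | good n b}, val n b) <
          (⨅ b ∈ {b | good n b}, val n b) + (n : ℝ≥0∞)⁻¹ :=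
        ENNReal.lt_add_right htop (ENNReal.inv_ne_zero.2 (ENNReal.natCast_ne_top n))
      obtain ⟨π, hπ⟩ := iInf_lt_iff.1 hlt
      obtain ⟨hg, hv⟩ := iInf_lt_iff.1 hπ
      exact ⟨π, hg, hv.le⟩
  choose π hgood hval using hsel
  refine ⟨π, hgood, tendsto_order.2 ⟨fun l hl => ?_, fun u hu => ?_⟩⟩
  · filter_upwards [eventually_ne_atTop 0] with n hn
    exact hl.trans_le (hlow n hn _ (hgood n))
  · obtain ⟨r, hLr, hru⟩ := exists_between hu
    obtain ⟨r', hrr', hr'u⟩ := exists_between hru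
    have hinv : ∀ᶠ n : ℕ in atTop, (n : ℝ≥0∞)⁻¹ < r' - r :=
      ENNReal.tendsto_inv_nat_nhds_zero.eventually (gt_mem_nhds (tsub_pos_of_lt hrr'))
    filter_upwards [hup r hLr, hinv] with n ⟨b, hb, hbr⟩ hn
    calc val n (π n) ≤ (⨅ b ∈ {b | good n b}, val n b) + (n : ℝ≥0∞)⁻¹ := hval n
      _ ≤ r + (r' - r) := add_le_add ((iInf₂_le b hb).trans hbr) hn.le
      _ = r' := add_tsub_cancel_of_le hrr'.le
      _ < u := hr'u

/-- The kernels over which the single-letter expression is minimized. -/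
def Admissible (pX : Measure ℝ≥0) (Pavg : ℝ≥0∞) (κ : Kernel ℝ≥0 ℝ≥0) : Prop :=
  IsMarkovKernel κ ∧ (∀ᵐ q ∂(pX ⊗ₘ κ), q.2 ≤ q.1 ∧ ENNReal.ofReal ((q.1 : ℝ) - q.2) ≤ ⊤) ∧
    ∫⁻ q, ENNReal.ofReal ((q.1 : ℝ) - q.2) ∂(pX ⊗ₘ κ) ≤ Pavg

/-- The choice `Y = X` draws no battery energy and so fits every budget; it guarantees that feasible
policies of every length exist. -/
lemma admissible_id (pX : Measure ℝ≥0) [IsProbabilityMeasure pX] (Pavg : ℝ≥0∞) :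
    Admissible pX Pavg Kernel.id := by
  have hm : Measurable (Function.diag : ℝ≥0 → ℝ≥0 × ℝ≥0) := measurable_id.prodMk measurable_id
  refine ⟨inferInstance, ?_, ?_⟩
  · rw [Measure.compProd_id, ae_map_iff hm.aemeasurable]
    · simp
    · simpa using measurableSet_le measurable_snd measurable_fst
  · rw [Measure.compProd_id, lintegral_map (by fun_prop) hm]
    simp

lemma exists_admissible_lt {pX : Measure ℝ≥0} {Pavg r : ℝ≥0∞}
    (h : singleLetterLeakage pX Pavg ⊤ < r) :
    ∃ κ, Admissible pX Pavg κ ∧ ∃ δ : ℝ, 0 < δ ∧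
      mutualInfo (pX ⊗ₘ κ) Prod.fst Prod.snd + ENNReal.ofReal δ ≤ r := by
  obtain ⟨κ, hκ⟩ := iInf_lt_iff.1 h
  obtain ⟨hadm, hlt⟩ := iInf_lt_iff.1 hκ
  obtain ⟨δ, hδ, hle⟩ := ENNReal.lt_iff_exists_add_pos_lt.1 hlt
  exact ⟨κ, hadm, δ, hδ, by rw [ENNReal.ofReal_coe_nnreal]; exact hle.le⟩

/-! ### Memoryless policies -/

/-- Sample `κ` independently in every slot and apply the reveal bound with empty events; `δ` pays
only for the coin that bound contains. -/
lemma exists_memoryless_powerPolicy {pX : Measure ℝ≥0} [IsProbabilityMeasure pX]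
    (hX : FiniteEntropy pX) {Pavg : ℝ≥0∞} {κ : Kernel ℝ≥0 ℝ≥0} (hκ : Admissible pX Pavg κ) {δ : ℝ}
    (hδ : 0 < δ) :
    ∃ π : PowerPolicy, (∀ n, π.Feasible pX Pavg ⊤ n) ∧ ∀ n ≠ 0, π.leakageRate pX n ≤
      mutualInfo (pX ⊗ₘ κ) Prod.fst Prod.snd + ENNReal.ofReal δ := by
  obtain ⟨hκM, hκle, hκavg⟩ := hκ
  obtain ⟨g, hg, hgκ⟩ := κ.exists_measurable_map_eq_unitInterval
  have hgc : ∀ {Ω : Type} [MeasurableSpace Ω] {x : Ω → ℝ≥0} {u : Ω → I}, Measurable x →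
      Measurable u → Measurable fun ω => g (x ω) (u ω) := fun hx hu => hg.comp (hx.prodMk hu)
  let π : PowerPolicy := ⟨fun t v => g (v.2.1 (Fin.last t)) v.1, fun t =>
    hgc (by fun_prop) (by fun_prop)⟩
  have hout : ∀ t ω, π.output t ω = g (ω t).1 (ω t).2 := fun t ω => by
    rw [PowerPolicy.output_eq]; rfl
  have hm : Measurable fun v : ℝ≥0 × I => (v.1, g v.1 v.2) := measurable_fst.prodMk hg
  have hlaw : ∀ n, (powerOutcomeLaw pX).map (fun ω (t : Fin n) => ((ω t).1, π.output t ω)) =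
      Measure.pi fun _ => pX ⊗ₘ κ := fun n => by
    simp only [hout]
    rw [← map_prod_eq_compProd pX κ hg hgκ]
    exact map_infinitePi_slotwise (pX.prod (volume : Measure I)) hm n
  have hpm : ∀ t, Measurable fun ω : PowerOutcome => ((ω t).1, π.output t ω) := fun t =>
    Measurable.prodMk (by fun_prop) (π.measurable_output t)
  have hlawt : ∀ t, (powerOutcomeLaw pX).map (fun ω => ((ω t).1, π.output t ω)) = pX ⊗ₘ κ :=
    fun t => map_eval_of_map_pi (X := fun (s : Fin (t + 1)) (ω : PowerOutcome) =>
      ((ω s).1, π.output s ω)) (fun s => hpm s) (hlaw (t + 1)) (Fin.last t)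
  refine ⟨π, fun n => ⟨ae_all_iff.2 fun t => ?_, ?_⟩, fun n hn => ?_⟩
  · have := hκle
    rw [← hlawt t] at this
    filter_upwards [ae_of_ae_map (hpm t).aemeasurable this] with ω hω _ using hω
  · have hmeas : ∀ t, Measurable fun ω : PowerOutcome =>
        ENNReal.ofReal (((ω t).1 : ℝ) - π.output t ω) := fun t => by
      have := π.measurable_output t
      fun_prop
    have hone : ∀ t, ∫⁻ ω, ENNReal.ofReal (((ω t).1 : ℝ) - π.output t ω) ∂(powerOutcomeLaw pX) ≤
        Pavg := fun t => by
      rw [← hlawt t, lintegral_map (by fun_prop) (hpm t)] at hκavg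
      exact hκavg
    simp only [div_eq_mul_inv]
    rw [lintegral_mul_const _ (Finset.measurable_sum _ fun t _ => hmeas t), ← div_eq_mul_inv,
      lintegral_finsetSum _ fun t _ => hmeas t]
    refine ENNReal.div_le_of_le_mul ?_
    calc _ ≤ ∑ _t ∈ Finset.range n, Pavg := Finset.sum_le_sum fun t _ => hone t
      _ = Pavg * n := by simp [mul_comm]
  · obtain ⟨C, -, hC⟩ := exists_leakage_le_of_reveal hX κ hδ
    have h := hC (μ := powerOutcomeLaw pX) (X := fun (t : Fin n) (ω : PowerOutcome) => (ω t).1)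
      (Yh := fun (t : Fin n) => π.output t) (Y := fun (t : Fin n) => π.output t) (Θ := fun _ => ∅)
      hn (fun t => by fun_prop) (fun t => π.measurable_output t) (fun t => π.measurable_output t)
      (hlaw n) (fun _ => MeasurableSet.empty) (by simp) (by simp)
    simp only [measureReal_empty, Finset.sum_const_zero, mul_zero, add_zero] at h
    exact h

/-! ### Battery dynamics -/

/-- The battery state at the beginning of slot `t`. -/
def Policy.battery (π : Policy) (t : ℕ) (ω : Outcome) : ℝ := (π.run ω t).2 (Fin.last t)

lemma Policy.measurable_battery (π : Policy) (t : ℕ) : Measurable (π.battery t) :=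
  (measurable_pi_apply _).comp (measurable_snd.comp (π.measurable_run t))

lemma Policy.output_eq (π : Policy) (t : ℕ) (ω : Outcome) :
    π.output t ω = π.alloc t (seed t ω, fun i => inputLoad i ω, (π.run ω t).1, (π.run ω t).2,
      harvest t ω) := by
  simp [Policy.output, Policy.run]

lemma Policy.battery_zero (π : Policy) (ω : Outcome) : π.battery 0 ω = 0 := rfl

lemma Policy.battery_succ (π : Policy) (t : ℕ) (ω : Outcome) :
    π.battery (t + 1) ω =
      nextBattery (π.battery t ω) (harvest t ω) (inputLoad t ω) (π.output t ω) := by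
  simp [Policy.battery, Policy.output, Policy.run]

/-- If the energy drawn from the battery never exceeds its state, no energy is lost in the
accounting. -/
lemma Policy.battery_eq_sum (π : Policy) (ω : Outcome)
    (h : ∀ t, (inputLoad t ω : ℝ) - π.output t ω ≤ π.battery t ω) (k : ℕ) :
    0 ≤ π.battery k ω ∧ π.battery k ω = ∑ t ∈ Finset.range k, (harvest t ω : ℝ) -
      ∑ t ∈ Finset.range k, ((inputLoad t ω : ℝ) - π.output t ω) := by
  induction k with
  | zero => simp [Policy.battery_zero]
  | succ k ih =>
    have h1 : (0 : ℝ) ≤ harvest k ω := NNReal.coe_nonneg _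
    have h2 := h k
    rw [Policy.battery_succ, nextBattery, Finset.sum_range_succ, Finset.sum_range_succ,
      max_eq_left (by linarith)]
    exact ⟨by linarith, by rw [ih.2]; ring⟩

/-! ### The policy that hides the load whenever the battery allows -/

/-- The output load is the proposed value `w.2`, unless the coin `w.1` is at most `ε`, the battery
state `s` does not suffice, or the proposed value exceeds the input load `x`; then it is `x`. -/
noncomputable def revealOrHide (ε : I) (s : ℝ) (x : ℝ≥0) (w : I × ℝ≥0) : ℝ≥0 :=
  if w.1 ≤ ε ∨ s < (x : ℝ) - w.2 ∨ x < w.2 then x else w.2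

lemma measurableSet_reveal {Ω : Type*} [MeasurableSpace Ω] (ε : I) {s : Ω → ℝ} {x : Ω → ℝ≥0}
    {w : Ω → I × ℝ≥0} (hs : Measurable s) (hx : Measurable x) (hw : Measurable w) :
    MeasurableSet {ω | (w ω).1 ≤ ε ∨ s ω < (x ω : ℝ) - (w ω).2 ∨ x ω < (w ω).2} := by
  have h1 : MeasurableSet {ω | (w ω).1 ≤ ε} := measurableSet_le hw.fst measurable_const
  have h2 : MeasurableSet {ω | s ω < (x ω : ℝ) - (w ω).2} :=
    measurableSet_lt hs (hx.coe_nnreal_real.sub hw.snd.coe_nnreal_real)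
  have h3 : MeasurableSet {ω | x ω < (w ω).2} := measurableSet_lt hx hw.snd
  exact h1.union (h2.union h3)

lemma measurable_revealOrHide {Ω : Type*} [MeasurableSpace Ω] (ε : I) {s : Ω → ℝ} {x : Ω → ℝ≥0}
    {w : Ω → I × ℝ≥0} (hs : Measurable s) (hx : Measurable x) (hw : Measurable w) :
    Measurable fun ω => revealOrHide ε (s ω) (x ω) (w ω) :=
  Measurable.ite (measurableSet_reveal ε hs hx hw) hx hw.snd

lemma revealOrHide_le (ε : I) (s : ℝ) (x : ℝ≥0) (w : I × ℝ≥0) : revealOrHide ε s x w ≤ x := by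
  unfold revealOrHide
  split_ifs with h
  · exact le_rfl
  · push Not at h; exact h.2.2

/-- The energy that a sufficiently charged battery would provide. -/
noncomputable def hiddenEnergy (ε : I) (x : ℝ≥0) (w : I × ℝ≥0) : ℝ≥0 :=
  if w.1 ≤ ε then 0 else x - w.2

lemma measurable_hiddenEnergy {Ω : Type*} [MeasurableSpace Ω] (ε : I) {x : Ω → ℝ≥0}
    {w : Ω → I × ℝ≥0} (hx : Measurable x) (hw : Measurable w) :
    Measurable fun ω => hiddenEnergy ε (x ω) (w ω) :=
  Measurable.ite (measurableSet_le hw.fst measurable_const) measurable_const (hx.sub hw.snd)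

lemma sub_revealOrHide_le (ε : I) (s : ℝ) (x : ℝ≥0) (w : I × ℝ≥0) :
    (x : ℝ) - revealOrHide ε s x w ≤ hiddenEnergy ε x w := by
  unfold revealOrHide hiddenEnergy
  split_ifs with h1 h2 h2
  · simp
  · simp
  · exact absurd (Or.inl h2) h1
  · push Not at h1
    rw [NNReal.coe_sub h1.2.2]

lemma sub_revealOrHide_le_battery (ε : I) {s : ℝ} (hs : 0 ≤ s) (x : ℝ≥0) (w : I × ℝ≥0) :
    (x : ℝ) - revealOrHide ε s x w ≤ s := by
  unfold revealOrHide
  split_ifs with h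
  · simpa using hs
  · push Not at h; exact h.2.1

/-- The map `ψ x` splits one seed into a coin and a proposed output; in the application these are
independent, with laws uniform and `κ x`. -/
noncomputable def revealPolicy (ε : I) (ψ : ℝ≥0 → I → I × ℝ≥0)
    (hψ : Measurable (Function.uncurry ψ)) : Policy where
  alloc t v := revealOrHide ε (v.2.2.2.1 (Fin.last t)) (v.2.1 (Fin.last t))
    (ψ (v.2.1 (Fin.last t)) v.1)
  measurable_alloc t := measurable_revealOrHide ε (by fun_prop) (by fun_prop)
    (hψ.comp (Measurable.prodMk (by fun_prop) (by fun_prop)))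

section RevealPolicy

variable {ε : I} {ψ : ℝ≥0 → I → I × ℝ≥0} {hψ : Measurable (Function.uncurry ψ)}

lemma revealPolicy_output (t : ℕ) (ω : Outcome) :
    (revealPolicy ε ψ hψ).output t ω = revealOrHide ε ((revealPolicy ε ψ hψ).battery t ω)
      (inputLoad t ω) (ψ (inputLoad t ω) (seed t ω)) := by
  rw [Policy.output_eq]; rfl

lemma revealPolicy_battery_nonneg (t : ℕ) (ω : Outcome) :
    0 ≤ (revealPolicy ε ψ hψ).battery t ω := by
  cases t with
  | zero => exact le_rfl
  | succ t => rw [Policy.battery_succ]; exact le_max_right _ _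

lemma revealPolicy_sub_le_battery (t : ℕ) (ω : Outcome) :
    (inputLoad t ω : ℝ) - (revealPolicy ε ψ hψ).output t ω ≤
      (revealPolicy ε ψ hψ).battery t ω := by
  rw [revealPolicy_output]
  exact sub_revealOrHide_le_battery ε (revealPolicy_battery_nonneg t ω) _ _

lemma revealPolicy_feasible (pX pE : Measure ℝ≥0) [IsProbabilityMeasure pX]
    [IsProbabilityMeasure pE] (n : ℕ) : (revealPolicy ε ψ hψ).Feasible pX pE n := by
  refine ae_of_all _ fun ω => ⟨fun t _ => ?_, fun k _ => ?_⟩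
  · rw [revealPolicy_output]; exact revealOrHide_le _ _ _ _
  · have := Policy.battery_eq_sum _ ω (fun t => revealPolicy_sub_le_battery (hψ := hψ) (ε := ε) t ω) k
    linarith [this.1, this.2]

/-- The actual draws depend on the battery history, but each is at most the hidden energy, a
function of its own slot alone. The battery thus dominates a difference of sums to which the strong
law applies. -/
lemma sum_sub_sum_hiddenEnergy_le_battery (t : ℕ) (ω : Outcome) :
    ∑ i ∈ Finset.range t, (harvest i ω : ℝ) -
      ∑ i ∈ Finset.range t,
        (hiddenEnergy ε (inputLoad i ω) (ψ (inputLoad i ω) (seed i ω)) : ℝ) ≤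
      (revealPolicy ε ψ hψ).battery t ω := by
  have h := (Policy.battery_eq_sum _ ω
    (fun t => revealPolicy_sub_le_battery (hψ := hψ) (ε := ε) t ω) t).2
  rw [h]
  refine sub_le_sub_left (Finset.sum_le_sum fun i _ => ?_) _
  rw [revealPolicy_output]
  exact sub_revealOrHide_le _ _ _ _

end RevealPolicy

/-! ### The strong law and achievability -/

lemma tendsto_average_slotwise {S : Type*} [MeasurableSpace S] {m : Measure S}
    [IsProbabilityMeasure m] {h : S → ℝ≥0} (hh : Measurable h) {c : ℝ≥0}
    (hc : ∫⁻ s, (h s : ℝ≥0∞) ∂m = c) :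
    ∀ᵐ ω ∂(Measure.infinitePi fun _ : ℕ => m),
      Tendsto (fun n : ℕ => (∑ i ∈ Finset.range n, (h (ω i) : ℝ)) / n) atTop (𝓝 c) := by
  have hlaw : ∀ i, (Measure.infinitePi fun _ : ℕ => m).map (fun ω => ω i) = m := fun i =>
    Measure.infinitePi_map_eval (fun _ : ℕ => m) i
  have hr : Measurable fun s => (h s : ℝ) := hh.coe_nnreal_real
  have hri : ∀ i : ℕ, Measurable fun ω : ℕ → S => (h (ω i) : ℝ) := fun i =>
    hr.comp (measurable_pi_apply i)
  have hl : ∫⁻ ω, ENNReal.ofReal (h (ω 0)) ∂(Measure.infinitePi fun _ : ℕ => m) = c := by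
    have := lintegral_map (μ := Measure.infinitePi fun _ : ℕ => m) hh.coe_nnreal_ennreal
      (measurable_pi_apply 0)
    rw [hlaw 0, hc] at this
    rw [this]
    simp
  have hnn : 0 ≤ᵐ[Measure.infinitePi fun _ : ℕ => m] fun ω => (h (ω 0) : ℝ) :=
    ae_of_all _ fun ω => NNReal.coe_nonneg _
  have hint : Integrable (fun ω : ℕ → S => (h (ω 0) : ℝ)) (Measure.infinitePi fun _ : ℕ => m) :=
    (lintegral_ofReal_ne_top_iff_integrable (hri 0).aestronglyMeasurable hnn).1
      (by rw [hl]; exact ENNReal.coe_ne_top)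
  have hind : iIndepFun (fun (i : ℕ) (ω : ℕ → S) => (h (ω i) : ℝ))
      (Measure.infinitePi fun _ : ℕ => m) := iIndepFun_infinitePi fun _ => hr
  have hmapi : ∀ i : ℕ, (Measure.infinitePi fun _ : ℕ => m).map (fun ω => (h (ω i) : ℝ)) =
      m.map fun s => (h s : ℝ) := fun i => by
    have := Measure.map_map (μ := Measure.infinitePi fun _ : ℕ => m) hr (measurable_pi_apply i)
    rw [hlaw i] at this
    exact this.symm
  have hslln := strong_law_ae_real (μ := Measure.infinitePi fun _ : ℕ => m)
    (fun i ω => (h (ω i) : ℝ)) hint (fun i j hij => hind.indepFun hij)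
    fun i => ⟨(hri i).aemeasurable, (hri 0).aemeasurable, by rw [hmapi, hmapi]⟩
  have hval : ∫ ω, (h (ω 0) : ℝ) ∂(Measure.infinitePi fun _ : ℕ => m) = c := by
    rw [integral_eq_lintegral_of_nonneg_ae hnn (hri 0).aestronglyMeasurable, hl]
    simp
  rw [hval] at hslln
  exact hslln

/-- If the mean inflow exceeds the mean outflow, the accumulated inflow eventually covers the
accumulated outflow including the current slot. -/
lemma eventually_sum_le_of_average {x y : ℕ → ℝ} {a b : ℝ} (hab : b < a)
    (hx : Tendsto (fun n : ℕ => (∑ i ∈ Finset.range n, x i) / n) atTop (𝓝 a))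
    (hy : Tendsto (fun n : ℕ => (∑ i ∈ Finset.range n, y i) / n) atTop (𝓝 b)) :
    ∀ᶠ n in atTop, ∑ i ∈ Finset.range (n + 1), y i ≤ ∑ i ∈ Finset.range n, x i := by
  have hy' := hy.comp (tendsto_add_atTop_nat 1)
  -- The factor `n / (n + 1)` puts the inflow over `n` slots on the same denominator as the outflow
  -- over `n + 1`.
  have hx' := hx.mul (tendsto_natCast_div_add_atTop (1 : ℝ))
  rw [mul_one] at hx'
  filter_upwards [hy'.eventually_lt hx' hab, eventually_ne_atTop 0] with n hn h0
  have h0' : (n : ℝ) ≠ 0 := by exact_mod_cast h0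
  have h1 : (0 : ℝ) < n + 1 := by positivity
  simp only [Function.comp_apply, Nat.cast_add, Nat.cast_one] at hn
  rw [div_mul_div_cancel₀ h0', div_lt_div_iff_of_pos_right h1] at hn
  exact hn.le

/-- Given the load, coin and proposal are independent, so the coin scales the mean demand by `1 -
ε`. -/
lemma lintegral_hiddenEnergy (pX : Measure ℝ≥0) [IsProbabilityMeasure pX] (κ : Kernel ℝ≥0 ℝ≥0)
    [IsMarkovKernel κ] (ε : I) :
    ∫⁻ v, (hiddenEnergy ε v.1 v.2 : ℝ≥0∞)
      ∂(pX ⊗ₘ (Kernel.const ℝ≥0 (volume : Measure I) ×ₖ κ)) =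
      ENNReal.ofReal (1 - ε) * ∫⁻ q, ENNReal.ofReal ((q.1 : ℝ) - q.2) ∂(pX ⊗ₘ κ) := by
  have hm : Measurable fun v : ℝ≥0 × I × ℝ≥0 => (hiddenEnergy ε v.1 v.2 : ℝ≥0∞) :=
    (measurable_hiddenEnergy ε measurable_fst measurable_snd).coe_nnreal_ennreal
  rw [Measure.lintegral_compProd hm, Measure.lintegral_compProd (by fun_prop),
    ← lintegral_const_mul _ (Measurable.lintegral_kernel_prod_right'
      (f := fun q : ℝ≥0 × ℝ≥0 => ENNReal.ofReal ((q.1 : ℝ) - q.2)) (by fun_prop))]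
  refine lintegral_congr fun x => ?_
  rw [Kernel.prod_apply, Kernel.const_apply]
  have hsplit : ∀ w : I × ℝ≥0, (hiddenEnergy ε x w : ℝ≥0∞) =
      (Set.Ioi ε).indicator (fun _ => 1) w.1 * ENNReal.ofReal ((x : ℝ) - w.2) := fun w => by
    unfold hiddenEnergy
    by_cases h : w.1 ≤ ε
    · simp [h]
    · rw [if_neg h, Set.indicator_of_mem (by simpa using h), one_mul, NNReal.sub_def]
      rfl
  simp only [hsplit]
  rw [lintegral_prod_mul (f := (Set.Ioi ε).indicator fun _ => 1)
    (g := fun y : ℝ≥0 => ENNReal.ofReal ((x : ℝ) - y))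
    (measurable_const.indicator measurableSet_Ioi).aemeasurable (by fun_prop),
    lintegral_indicator measurableSet_Ioi, setLIntegral_const, one_mul,
    unitInterval.volume_Ioi]

/-- Every admissible single-letter rate is achieved up to `δ` by one feasible policy that does not
use the current harvest. -/
theorem exists_revealPolicy_leakageRate_le {pX pE : Measure ℝ≥0} [IsProbabilityMeasure pX]
    [IsProbabilityMeasure pE] (hX : FiniteEntropy pX) {PE : ℝ≥0}
    (hPE : ∫⁻ e, (e : ℝ≥0∞) ∂pE = PE) {κ : Kernel ℝ≥0 ℝ≥0} (hκ : Admissible pX PE κ) {δ : ℝ}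
    (hδ : 0 < δ) :
    ∃ π : Policy, π.IgnoresCurrentHarvest ∧ (∀ n, π.Feasible pX pE n) ∧
      ∀ᶠ n in atTop, π.leakageRate pX pE n ≤
        mutualInfo (pX ⊗ₘ κ) Prod.fst Prod.snd + ENNReal.ofReal δ := by
  obtain ⟨hκM, hκle, hκavg⟩ := hκ
  obtain ⟨C, hC0, hC⟩ := exists_leakage_le_of_reveal hX κ (show 0 < δ / 3 by linarith)
  -- The slack `δ` is split in thirds: the reveal bound, the coin (`C ε ≤ δ/3`), and the averaged
  -- probability of battery failure. The `min` with `1` keeps `ε` in the unit interval.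
  have hε0' : 0 < min 1 (δ / (3 * (C + 1))) := lt_min one_pos (by positivity)
  let ε : I := ⟨min 1 (δ / (3 * (C + 1))), hε0'.le, min_le_left _ _⟩
  have hε0 : (0 : ℝ) < ε := hε0'
  have hCε : C * ε ≤ δ / 3 := by
    have h1 : (ε : ℝ) ≤ δ / (3 * (C + 1)) := min_le_right _ _
    calc C * ε ≤ C * (δ / (3 * (C + 1))) := by gcongr
      _ = δ / 3 * (C / (C + 1)) := by field_simp
      _ ≤ δ / 3 * 1 := by
          gcongr
          rw [div_le_one (by linarith)]; linarith
      _ = δ / 3 := mul_one _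
  let η : Kernel ℝ≥0 (I × ℝ≥0) := Kernel.const ℝ≥0 (volume : Measure I) ×ₖ κ
  obtain ⟨ψ, hψ, hψη⟩ := η.exists_measurable_map_eq_unitInterval
  let π := revealPolicy ε ψ hψ
  set μ := outcomeLaw pX pE with hμ
  have hψp : Measurable fun v : ℝ≥0 × I => (v.1, ψ v.1 v.2) := measurable_fst.prodMk hψ
  let slotLaw : Measure (ℝ≥0 × ℝ≥0 × I) := pX.prod (pE.prod (volume : Measure I))
  have hψm : Measurable fun v : ℝ≥0 × ℝ≥0 × I => ψ v.1 v.2.2 :=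
    hψ.comp (measurable_fst.prodMk (measurable_snd.comp measurable_snd))
  have hslot : slotLaw.map (fun v => (v.1, ψ v.1 v.2.2)) = pX ⊗ₘ η := by
    have h1 : slotLaw.map (Prod.map id Prod.snd) = pX.prod (volume : Measure I) :=
      ((MeasurePreserving.id pX).prod (measurePreserving_snd (μ := pE)
        (ν := (volume : Measure I)))).map_eq
    rw [← map_prod_eq_compProd pX η hψ hψη, ← h1,
      Measure.map_map hψp (measurable_id.prodMap measurable_snd)]
    rfl
  have hη2 : (pX ⊗ₘ η).map (fun v => (v.1, v.2.2)) = pX ⊗ₘ κ := by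
    have hκψ : ∀ x, (volume : Measure I).map (fun u => (ψ x u).2) = κ x := fun x => by
      have hx : Measurable (ψ x) := hψ.comp measurable_prodMk_left
      have := Measure.map_map (μ := (volume : Measure I)) measurable_snd hx
      rw [hψη x, Kernel.prod_apply, Measure.map_snd_prod, Kernel.const_apply, measure_univ,
        one_smul] at this
      exact this.symm
    rw [← map_prod_eq_compProd pX η hψ hψη, ← map_prod_eq_compProd pX κ
      (g := fun x u => (ψ x u).2) (measurable_snd.comp hψ) hκψ,
      Measure.map_map (by fun_prop) hψp]
    rfl
  have hslotκ : slotLaw.map (fun v => (v.1, (ψ v.1 v.2.2).2)) = pX ⊗ₘ κ := by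
    rw [← hη2, ← hslot, Measure.map_map (by fun_prop) (measurable_fst.prodMk hψm)]
    rfl
  have hevalm : ∀ t, μ.map (fun ω => ω t) = slotLaw := fun t =>
    Measure.infinitePi_map_eval (fun _ : ℕ => slotLaw) t
  have hX_m := measurable_inputLoad
  have hwm : ∀ t, Measurable fun ω : Outcome => ψ (inputLoad t ω) (seed t ω) := fun t =>
    hψ.comp ((hX_m t).prodMk (measurable_seed t))
  let B : ℕ → Set Outcome := fun t => {ω | π.battery t ω <
    hiddenEnergy ε (inputLoad t ω) (ψ (inputLoad t ω) (seed t ω))}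
  have hBm : ∀ t, MeasurableSet (B t) := fun t => measurableSet_lt (π.measurable_battery t)
    (measurable_hiddenEnergy ε (hX_m t) (hwm t)).coe_nnreal_real
  let Θ : ℕ → Set Outcome := fun t => {ω | (ψ (inputLoad t ω) (seed t ω)).1 ≤ ε ∨
    π.battery t ω < (inputLoad t ω : ℝ) - (ψ (inputLoad t ω) (seed t ω)).2 ∨
    inputLoad t ω < (ψ (inputLoad t ω) (seed t ω)).2}
  have hΘm : ∀ t, MeasurableSet (Θ t) := fun t =>
    measurableSet_reveal ε (π.measurable_battery t) (hX_m t) (hwm t)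
  have hhm : Measurable fun v : ℝ≥0 × ℝ≥0 × I => hiddenEnergy ε v.1 (ψ v.1 v.2.2) :=
    measurable_hiddenEnergy ε measurable_fst hψm
  have hhint : ∫⁻ v, (hiddenEnergy ε v.1 (ψ v.1 v.2.2) : ℝ≥0∞) ∂slotLaw =
      ENNReal.ofReal (1 - ε) * ∫⁻ q, ENNReal.ofReal ((q.1 : ℝ) - q.2) ∂(pX ⊗ₘ κ) := by
    rw [← lintegral_hiddenEnergy pX κ ε]
    change _ = ∫⁻ v, (hiddenEnergy ε v.1 v.2 : ℝ≥0∞) ∂(pX ⊗ₘ η)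
    rw [← hslot, lintegral_map (measurable_hiddenEnergy ε measurable_fst
      measurable_snd).coe_nnreal_ennreal (measurable_fst.prodMk hψm)]
  have hB : Tendsto (fun t => μ (B t)) atTop (𝓝 0) := by
    have hev : ∀ᵐ ω ∂μ, ∀ᶠ t in atTop, ω ∉ B t := by
      -- With no harvest there is no drift, but admissibility forces zero mean demand, so an empty
      -- battery suffices almost surely.
      by_cases hPE0 : PE = 0
      · have hz : ∀ᵐ v ∂slotLaw, hiddenEnergy ε v.1 (ψ v.1 v.2.2) = 0 := by
          have h0 : ∫⁻ v, (hiddenEnergy ε v.1 (ψ v.1 v.2.2) : ℝ≥0∞) ∂slotLaw = 0 := by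
            rw [hhint]
            have : ∫⁻ q, ENNReal.ofReal ((q.1 : ℝ) - q.2) ∂(pX ⊗ₘ κ) = 0 :=
              le_antisymm (by simpa [hPE0] using hκavg) zero_le
            rw [this, mul_zero]
          rw [lintegral_eq_zero_iff hhm.coe_nnreal_ennreal] at h0
          filter_upwards [h0] with v hv using by simpa using hv
        have hall : ∀ᵐ ω ∂μ, ∀ t,
            hiddenEnergy ε (inputLoad t ω) (ψ (inputLoad t ω) (seed t ω)) = 0 :=
          ae_all_iff.2 fun t => by
            rw [← hevalm t] at hz
            exact ae_of_ae_map (measurable_pi_apply t).aemeasurable hz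
        filter_upwards [hall] with ω hω
        refine Eventually.of_forall fun t ht => ?_
        have h1 : π.battery t ω <
            hiddenEnergy ε (inputLoad t ω) (ψ (inputLoad t ω) (seed t ω)) := ht
        rw [hω t] at h1
        exact absurd (revealPolicy_battery_nonneg t ω) (not_le.2 h1)
      · set M := ∫⁻ q, ENNReal.ofReal ((q.1 : ℝ) - q.2) ∂(pX ⊗ₘ κ)
        -- The purpose of the coin: a strict gap even when `κ` exhausts the budget, `M = PE`.
        have hlt : ENNReal.ofReal (1 - ε) * M < PE := by
          rcases eq_or_ne M 0 with h0 | h0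
          · rw [h0, mul_zero]
            exact_mod_cast pos_iff_ne_zero.2 hPE0
          · have hMt : M ≠ ∞ := ne_top_of_le_ne_top ENNReal.coe_ne_top hκavg
            calc ENNReal.ofReal (1 - ε) * M < 1 * M := by
                  refine ENNReal.mul_lt_mul_left h0 hMt ?_
                  rw [← ENNReal.ofReal_one]
                  exact (ENNReal.ofReal_lt_ofReal_iff one_pos).2 (by linarith)
              _ ≤ PE := by rwa [one_mul]
        obtain ⟨d, hd⟩ : ∃ d : ℝ≥0, (d : ℝ≥0∞) = ENNReal.ofReal (1 - ε) * M :=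
          ⟨_, ENNReal.coe_toNNReal hlt.ne_top⟩
        rw [← hd] at hlt hhint
        have hdPE : (d : ℝ) < PE := by exact_mod_cast hlt
        have hEm : Measurable fun v : ℝ≥0 × ℝ≥0 × I => v.2.1 := by fun_prop
        have hEint : ∫⁻ v, (v.2.1 : ℝ≥0∞) ∂slotLaw = PE := by
          rw [← hPE, ← map_harvest pX pE 0, lintegral_map measurable_coe_nnreal_ennreal
            (measurable_harvest 0), ← hevalm 0, lintegral_map hEm.coe_nnreal_ennreal
            (measurable_pi_apply 0)]
          rfl
        filter_upwards [tendsto_average_slotwise (m := slotLaw) hEm hEint,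
          tendsto_average_slotwise (m := slotLaw) hhm hhint] with ω h1 h2
        filter_upwards [eventually_sum_le_of_average hdPE h1 h2] with t ht htB
        have h3 := sum_sub_sum_hiddenEnergy_le_battery (ε := ε) (hψ := hψ) t ω
        have h4 : π.battery t ω <
            hiddenEnergy ε (inputLoad t ω) (ψ (inputLoad t ω) (seed t ω)) := htB
        rw [Finset.sum_range_succ] at ht
        simp only [inputLoad, seed, harvest] at h3 h4
        linarith
    have := tendsto_measure_of_ae_tendsto_indicator_of_isFiniteMeasure (μ := μ) atTop
      (A := ∅) MeasurableSet.empty hBm (by simpa using hev)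
    simpa using this
  have hBr : Tendsto (fun t => μ.real (B t)) atTop (𝓝 0) := by
    exact (ENNReal.tendsto_toReal ENNReal.zero_ne_top).comp hB
  -- A slot is revealed by the coin, by a battery shortage, or because the proposal exceeds the
  -- load; the last event is null by admissibility.
  have hΘB : ∀ t, μ.real (Θ t) ≤ ε + μ.real (B t) := by
    intro t
    have hpairm : Measurable fun ω : Outcome =>
        (inputLoad t ω, ψ (inputLoad t ω) (seed t ω)) := (hX_m t).prodMk (hwm t)
    have hpair : μ.map (fun ω => (inputLoad t ω, ψ (inputLoad t ω) (seed t ω))) = pX ⊗ₘ η := by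
      rw [← hslot, ← hevalm t, Measure.map_map (measurable_fst.prodMk hψm) (measurable_pi_apply t)]
      rfl
    have hcoin : μ {ω | (ψ (inputLoad t ω) (seed t ω)).1 ≤ ε} = ENNReal.ofReal ε := by
      have hs : MeasurableSet {v : ℝ≥0 × I × ℝ≥0 | v.2.1 ≤ ε} :=
        measurableSet_le (measurable_fst.comp measurable_snd) measurable_const
      have h1 : μ {ω | (ψ (inputLoad t ω) (seed t ω)).1 ≤ ε} =
          (pX ⊗ₘ η) {v | v.2.1 ≤ ε} := by
        rw [← hpair, Measure.map_apply hpairm hs]; rfl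
      rw [h1, Measure.compProd_apply hs]
      have h2 : ∀ x, η x (Prod.mk x ⁻¹' {v : ℝ≥0 × I × ℝ≥0 | v.2.1 ≤ ε}) = ENNReal.ofReal ε :=
        fun x => by
          have : Prod.mk x ⁻¹' {v : ℝ≥0 × I × ℝ≥0 | v.2.1 ≤ ε} = Set.Iic ε ×ˢ Set.univ := by
            ext ⟨c, y⟩; simp
          rw [this, Kernel.prod_apply, Kernel.const_apply, Measure.prod_prod,
            unitInterval.volume_Iic, measure_univ, mul_one]
      rw [lintegral_congr h2]
      simp
    have hle0 : ∀ᵐ ω ∂μ, (ψ (inputLoad t ω) (seed t ω)).2 ≤ inputLoad t ω := by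
      have h1 : ∀ᵐ q ∂((pX ⊗ₘ η).map fun v => (v.1, v.2.2)), q.2 ≤ q.1 := by
        rw [hη2]
        filter_upwards [hκle] with q hq using hq.1
      have h2 := ae_of_ae_map (by fun_prop) h1
      rw [← hpair] at h2
      exact ae_of_ae_map hpairm.aemeasurable h2
    have hsub : μ (Θ t) ≤ μ ({ω | (ψ (inputLoad t ω) (seed t ω)).1 ≤ ε} ∪ B t) := by
      refine measure_mono_ae ?_
      filter_upwards [hle0] with ω hω hωΘ
      by_cases hc : (ψ (inputLoad t ω) (seed t ω)).1 ≤ ε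
      · exact Or.inl hc
      · refine Or.inr ?_
        rcases hωΘ with h | h | h
        · exact absurd h hc
        · change π.battery t ω < hiddenEnergy ε (inputLoad t ω) (ψ (inputLoad t ω) (seed t ω))
          rw [hiddenEnergy, if_neg hc, NNReal.coe_sub hω]
          exact h
        · exact absurd hω (not_le.2 h)
    have hfin := (hsub.trans (measure_union_le _ _))
    rw [hcoin] at hfin
    have := ENNReal.toReal_mono (ENNReal.add_ne_top.2 ⟨ENNReal.ofReal_ne_top, measure_ne_top _ _⟩)
      hfin
    rwa [ENNReal.toReal_add ENNReal.ofReal_ne_top (measure_ne_top _ _),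
      ENNReal.toReal_ofReal hε0.le] at this
  refine ⟨π, fun t u x y s e e' => rfl, fun n => revealPolicy_feasible pX pE n, ?_⟩
  have hces : Tendsto (fun n : ℕ => C * ((n : ℝ)⁻¹ * ∑ t ∈ Finset.range n, μ.real (B t))) atTop
      (𝓝 0) := by simpa using hBr.cesaro.const_mul C
  filter_upwards [hces.eventually (gt_mem_nhds (show (0 : ℝ) < δ / 3 by linarith)),
    eventually_ne_atTop 0] with n hn hn0
  have hlaw : μ.map (fun ω (t : Fin n) => (inputLoad t ω, (ψ (inputLoad t ω) (seed t ω)).2)) =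
      Measure.pi fun _ => pX ⊗ₘ κ := by
    rw [← hslotκ]
    exact map_infinitePi_slotwise slotLaw (measurable_fst.prodMk (measurable_snd.comp hψm)) n
  have hmain := hC (μ := μ) (n := n) (X := fun (t : Fin n) => inputLoad t)
    (Yh := fun (t : Fin n) ω => (ψ (inputLoad t ω) (seed t ω)).2)
    (Y := fun (t : Fin n) => π.output t) (Θ := fun t : Fin n => Θ t) hn0
    (fun t => hX_m t) (fun t => measurable_snd.comp (hwm t)) (fun t => π.measurable_output t) hlaw
    (fun t => hΘm t)
    (fun t ω hω => by rw [revealPolicy_output]; exact if_pos hω)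
    (fun t ω hω => by rw [revealPolicy_output]; exact if_neg hω)
  refine hmain.trans ?_
  gcongr
  rw [Fin.sum_univ_eq_sum_range (fun t => μ.real (Θ t)) n]
  have hn' : (n : ℝ) ≠ 0 := by exact_mod_cast hn0
  have hsum : (n : ℝ)⁻¹ * ∑ t ∈ Finset.range n, μ.real (Θ t) ≤
      ε + (n : ℝ)⁻¹ * ∑ t ∈ Finset.range n, μ.real (B t) := by
    calc _ ≤ (n : ℝ)⁻¹ * ∑ t ∈ Finset.range n, ((ε : ℝ) + μ.real (B t)) := by
          gcongr with t _; exact hΘB t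
      _ = _ := by
          rw [Finset.sum_add_distrib, mul_add]
          congr 1
          simp only [Finset.sum_const, Finset.card_range, nsmul_eq_mul]
          field_simp
  have := mul_le_mul_of_nonneg_left hsum hC0
  rw [mul_add] at this
  linarith

/-! ### Equality of the infima -/

/-- The converse covers all feasible policies and the achieving ones ignore the current harvest, so
every class containing the latter has the same value. -/
lemma minLeakageRate_eq {pX pE : Measure ℝ≥0} [IsProbabilityMeasure pX] [IsProbabilityMeasure pE]
    (hX : FiniteEntropy pX) {PE : ℝ≥0} (hPE : ∫⁻ e, (e : ℝ≥0∞) ∂pE = PE) {𝒞 : Set Policy}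
    (h𝒞 : ∀ π : Policy, π.IgnoresCurrentHarvest → π ∈ 𝒞) :
    minLeakageRate pX pE 𝒞 = singleLetterLeakage pX PE ⊤ := by
  have hlow : ∀ n ≠ 0, ∀ π : Policy, π.Feasible pX pE n →
      singleLetterLeakage pX PE ⊤ ≤ π.leakageRate pX pE n := fun n hn π hπ => by
    rw [← hPE]; exact singleLetterLeakage_le_leakageRate hX hn hπ
  refine le_antisymm (sInf_le ?_) (le_sInf ?_)
  · obtain ⟨π, hπ, hlim⟩ := exists_seq_tendsto
      (good := fun n (π : Policy) => π ∈ 𝒞 ∧ π.Feasible pX pE n)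
      (val := fun n π => π.leakageRate pX pE n) (L := singleLetterLeakage pX PE ⊤)
      (fun n => by
        obtain ⟨π, hi, hf, -⟩ :=
          exists_revealPolicy_leakageRate_le hX hPE (admissible_id pX PE) one_pos
        exact ⟨π, h𝒞 π hi, hf n⟩)
      (fun n hn π hπ => hlow n hn π hπ.2)
      (fun r hr => by
        obtain ⟨κ, hκ, δ, hδ, hle⟩ := exists_admissible_lt hr
        obtain ⟨π, hi, hf, hev⟩ := exists_revealPolicy_leakageRate_le hX hPE hκ hδ
        filter_upwards [hev] with n hn
        exact ⟨π, ⟨h𝒞 π hi, hf n⟩, hn.trans hle⟩)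
    exact ⟨π, hπ, _, le_rfl, hlim⟩
  · rintro r ⟨π, hπ, l, hlr, hlim⟩
    refine le_trans (ge_of_tendsto hlim ?_) hlr
    filter_upwards [eventually_ne_atTop 0] with n hn
    exact hlow n hn _ (hπ n).2

lemma privacyPower_eq_singleLetterLeakage {pX : Measure ℝ≥0} [IsProbabilityMeasure pX]
    (hX : FiniteEntropy pX) (Pavg : ℝ≥0∞) :
    privacyPower pX Pavg ⊤ = singleLetterLeakage pX Pavg ⊤ := by
  refine le_antisymm (sInf_le ?_) (le_sInf ?_)
  · obtain ⟨π, hπ, hlim⟩ := exists_seq_tendsto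
      (good := fun n (π : PowerPolicy) => π.Feasible pX Pavg ⊤ n)
      (val := fun n π => π.leakageRate pX n) (L := singleLetterLeakage pX Pavg ⊤)
      (fun n => by
        obtain ⟨π, hf, -⟩ := exists_memoryless_powerPolicy hX (admissible_id pX Pavg) one_pos
        exact ⟨π, hf n⟩)
      (fun n hn π hπ => singleLetterLeakage_le_power_leakageRate hX hn hπ)
      (fun r hr => by
        obtain ⟨κ, hκ, δ, hδ, hle⟩ := exists_admissible_lt hr
        obtain ⟨π, hf, hrate⟩ := exists_memoryless_powerPolicy hX hκ hδ
        filter_upwards [eventually_ne_atTop 0] with n hn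
        exact ⟨π, hf n, (hrate n hn).trans hle⟩)
    exact ⟨π, hπ, _, le_rfl, hlim⟩
  · rintro r ⟨π, hπ, l, hlr, hlim⟩
    refine le_trans (ge_of_tendsto hlim ?_) hlr
    filter_upwards [eventually_ne_atTop 0] with n hn
    exact singleLetterLeakage_le_power_leakageRate hX hn (hπ n)

end SmartMeter

theorem theorem2 (pX pE : MeasureTheory.Measure NNReal)
    [MeasureTheory.IsProbabilityMeasure pX] [MeasureTheory.IsProbabilityMeasure pE]
    (hX : SmartMeter.FiniteEntropy pX)
    (PE : ℝ≥0) (hPE : ∫⁻ e, (e : ℝ≥0∞) ∂pE = PE) :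
    SmartMeter.minLeakageRate pX pE Set.univ = SmartMeter.privacyPower pX PE ⊤ ∧
    SmartMeter.minLeakageRate pX pE {π | π.IgnoresCurrentHarvest} =
      SmartMeter.privacyPower pX PE ⊤ ∧
    SmartMeter.privacyPower pX PE ⊤ = SmartMeter.singleLetterLeakage pX PE ⊤ := by
  have hpower := SmartMeter.privacyPower_eq_singleLetterLeakage hX (PE : ℝ≥0∞)
  refine ⟨?_, ?_, hpower⟩
  · rw [hpower]
    exact SmartMeter.minLeakageRate_eq hX hPE fun π _ => Set.mem_univ π
  · rw [hpower]
    exact SmartMeter.minLeakageRate_eq hX hPE fun π hπ => hπ
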